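/- Let $\nu(dx)=dx/\sqrt{2\pi}$ on $\mathbb R$ and $\mathcal H=L^2(\mathbb R,\nu)$. Let $\mathbb R$ act on $\mathcal H$ by the unitaries $(f(g)\phi)(\lambda)=e^{i\lambda g}\phi(\lambda)$ (the shift action, in the Fourier picture). Let $(Q\phi)(\lambda)=\lambda\phi(\lambda)$, $P=-i\,d/d\lambda$, and let $F^{-1}[\phi](g)=\int e^{-i\lambda g}\phi(\lambda)\,\nu(d\lambda)$ be the unitary inverse Fourier transform on $\mathcal H$. Write $\langle\phi|Q^2|\phi\rangle=\int\lambda^2|\phi(\lambda)|^2\nu(d\lambda)$ and $\langle\phi|P^2|\phi\rangle=\|P\phi\|^2$, each being $+\infty$ when $\phi$ is not in the domain of $Q$, respectively $P$. A POVM $M$ on $\mathcal H$ with values in $\mathbb R$ is covariant if $f(g)M(B)f(g)^\dagger=M(g+B)$ for all $g\in\mathbb R$ and Borel $B$; $\mathcal M_{\rm cov}$ is the set of covariant POVMs, and $\mathcal S(\mathcal H)$ is the set of density operators. The worst-case mean square error is $$\mathcal D(\rho,M)=\sup_{g\in\mathbb R}\int(\hat g-g)^2\,\mathrm{Tr}\,f(g)\rho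 f(g)^\dagger M(d\hat g)\in[0,\infty].$$ Let $E>0$ and $\phi_E(\lambda)=E^{-1/4}e^{-\lambda^2/(4E)}$. **Theorem.** The following minima all exist and are equal to $\frac1{4E}$: 1. (Scheme 1) $\min\{\mathcal D(\rho,M):\rho\in\mathcal S(\mathcal H),\ M\in\mathcal M_{\rm cov},\ \mathrm{Tr}\,\rho Q^2\le E\}$; 2. (Scheme 2) $\min\{\sum_i p_i\mathcal D(\rho_i,M_i):\sum_i p_i\,\mathrm{Tr}\,\rho_iQ^2\le E\}$, over probability distributions $(p_i)_{i\in\mathbb N}$, $\rho_i\in\mathcal S(\mathcal H)$ and $M_i\in\mathcal M_{\rm cov}$; 3. $\min\{\int\hat g^2|F^{-1}[\phi](\hat g)|^2\nu(d\hat g):\|\phi\|=1,\ \langle\phi|Q^2|\phi\rangle\le E\}$; 4. $\min\{\langle\phi|P^2|\phi\rangle:\|\phi\|=1,\ \langle\phi|Q^2|\phi\rangle\le E\}$. The minimum in 3, and likewise in 4, is attained by $\phi$ if and only if $\phi=c\,\phi_E$ almost everywhere for a constant $c\in\mathbb C$ with $|c|=1$. The inverse Fourier transform of $\phi_E$ is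 $F^{-1}[\phi_E](g)=(4E)^{1/4}e^{-Eg^2}$. There is a covariant POVM $M_0$ with $\langle\phi|M_0(B)|\phi\rangle=\int_B|F^{-1}[\phi]|^2d\nu$ for all $\phi\in\mathcal H$ and Borel $B$. With this measurement, an admissible $\rho$ attains the minimum in Scheme 1 if and only if $\rho=|\phi_E\rangle\langle\phi_E|$, and an admissible $(p_i,\rho_i)$ (with $M_i=M_0$ for all $i$) attains the minimum in Scheme 2 if and only if $\rho_i=|\phi_E\rangle\langle\phi_E|$ whenever $p_i>0$. If the covariant measurements may be chosen freely, an admissible input $\rho$ attains the minimum in Scheme 1, with some $M\in\mathcal M_{\rm cov}$, if and only if $\rho=|\phi\rangle\langle\phi|$ with $|\phi(\lambda)|=\phi_E(\lambda)$ almost everywhere (the Gaussian up to a $\lambda$-dependent phase), and an admissible $(p_i,\rho_i)$ attains the minimum in Scheme 2, with some $M_i\in\mathcal M_{\rm cov}$, if and only if every $\rho_i$ with $p_i>0$ is of this form. -/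

import Mathlib

open MeasureTheory
open scoped ENNReal InnerProductSpace FourierTransform ContDiff

noncomputable section

namespace RealShift

/-! ### States, traces and POVMs on a complex Hilbert space -/

section Hilbert

variable {H : Type*} [NormedAddCommGroup H] [InnerProductSpace ℂ H] [CompleteSpace H]

/-- The trace of a positive operator, with values in `[0, ∞]`, computed in the Hilbert basis `b`. -/
def traceIn {ι : Type*} (b : HilbertBasis ι ℂ H) (A : H →L[ℂ] H) : ℝ≥0∞ :=
  ∑' i, ENNReal.ofReal (⟪b i, A (b i)⟫_ℂ).re

variable (H) in
/-- The index set of a fixed Hilbert basis of `H`. -/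
def basisSet : Set H := (exists_hilbertBasis ℂ H).choose

variable (H) in
/-- A fixed Hilbert basis of `H`. -/
def basis : HilbertBasis (basisSet H) ℂ H := (exists_hilbertBasis ℂ H).choose_spec.choose

/-- The trace of a positive operator, with values in `[0, ∞]`.
It does not depend on the basis, see `trace_eq_traceIn`. -/
def trace (A : H →L[ℂ] H) : ℝ≥0∞ := traceIn (basis H) A

lemma sqrt_inner_comm (A : H →L[ℂ] H) (x y : H) :
    ⟪x, CFC.sqrt A y⟫_ℂ = ⟪CFC.sqrt A x, y⟫_ℂ := by
  have h := (ContinuousLinearMap.nonneg_iff_isPositive _).1 (CFC.sqrt_nonneg A)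
  exact (h.isSymmetric x y).symm

lemma inner_sqrt_sandwich (A B : H →L[ℂ] H) (x : H) :
    ⟪x, (CFC.sqrt A ∘L B ∘L CFC.sqrt A) x⟫_ℂ = ⟪CFC.sqrt A x, B (CFC.sqrt A x)⟫_ℂ := by
  simp only [ContinuousLinearMap.comp_apply]
  exact sqrt_inner_comm A x _

lemma parseval {ι : Type*} (b : HilbertBasis ι ℂ H) (x : H) :
    ENNReal.ofReal (‖x‖ ^ 2) = ∑' j, ENNReal.ofReal (‖⟪b j, x⟫_ℂ‖ ^ 2) := by
  have h := b.hasSum_inner_mul_inner x x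
  have h2 := Complex.hasSum_re h
  have e : (fun j => (⟪x, b j⟫_ℂ * ⟪b j, x⟫_ℂ).re) = fun j => ‖⟪b j, x⟫_ℂ‖ ^ 2 := by
    funext j
    rw [← inner_conj_symm x (b j), Complex.conj_mul']
    norm_cast
  have e2 : (⟪x, x⟫_ℂ).re = ‖x‖ ^ 2 := by
    rw [inner_self_eq_norm_sq_to_K]; norm_cast
  rw [e, e2] at h2
  rw [← h2.tsum_eq, ENNReal.ofReal_tsum_of_nonneg (fun _ => by positivity) h2.summable]

lemma traceIn_eq {ι : Type*} (b : HilbertBasis ι ℂ H) {A : H →L[ℂ] H} (hA : A.IsPositive) :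
    traceIn b A = ∑' k, ENNReal.ofReal (‖CFC.sqrt A (b k)‖ ^ 2) := by
  refine tsum_congr fun k => ?_
  have h0 : 0 ≤ A := (ContinuousLinearMap.nonneg_iff_isPositive _).2 hA
  have h1 : A (b k) = CFC.sqrt A (CFC.sqrt A (b k)) := by
    conv_lhs => rw [← CFC.sqrt_mul_sqrt_self A h0]
    rfl
  rw [h1, sqrt_inner_comm, inner_self_eq_norm_sq_to_K]
  norm_cast

/-- The trace of a positive operator does not depend on the basis. -/
theorem trace_eq_traceIn {ι : Type*} (b : HilbertBasis ι ℂ H) {A : H →L[ℂ] H}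
    (hA : A.IsPositive) : trace A = traceIn b A := by
  rw [trace, traceIn_eq _ hA, traceIn_eq _ hA]
  simp_rw [parseval b (CFC.sqrt A (basis H _)), parseval (basis H) (CFC.sqrt A (b _))]
  rw [ENNReal.tsum_comm]
  refine tsum_congr fun i => tsum_congr fun j => ?_
  rw [sqrt_inner_comm, norm_inner_symm]

/-- `Tr ρ A = Tr √ρ A √ρ` for a density `ρ` and a possibly unbounded positive self-adjoint operator
`A` with quadratic form `q x = ⟨x|A|x⟩ = ‖√A x‖²` (`q x = ∞` off the form domain). -/
def traceForm (ρ : H →L[ℂ] H) (q : H → ℝ≥0∞) : ℝ≥0∞ :=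
  ∑' i, q (CFC.sqrt ρ (basis H i))

variable (H) in
/-- A density operator: a positive operator of trace one. -/
structure DensityOp where
  op : H →L[ℂ] H
  isPositive : op.IsPositive
  trace_eq_one : trace op = 1

variable (H) in
/-- A positive operator valued measure on `ℝ` (the values at non-measurable sets are irrelevant). -/
structure POVM where
  eff : Set ℝ → (H →L[ℂ] H)
  isPositive : ∀ B, MeasurableSet B → (eff B).IsPositive
  eff_univ : eff Set.univ = 1
  hasSum_eff : ∀ B : ℕ → Set ℝ, (∀ n, MeasurableSet (B n)) →
    Pairwise (Function.onFun Disjoint B) → ∀ x : H,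
      HasSum (fun n => ⟪x, eff (B n) x⟫_ℂ) ⟪x, eff (⋃ n, B n) x⟫_ℂ

lemma POVM.inner_empty (M : POVM H) (x : H) : ⟪x, M.eff ∅ x⟫_ℂ = 0 := by
  have h := M.hasSum_eff (fun _ => ∅) (fun _ => MeasurableSet.empty)
    (fun _ _ _ => by simp [Function.onFun]) x
  exact summable_const_iff _ |>.1 h.summable

/-- The distribution `B ↦ Tr ρ M(B) = Tr √ρ M(B) √ρ` of the outcome of the measurement `M`
of the positive operator `ρ`. -/
def POVM.outcome (M : POVM H) (ρ : H →L[ℂ] H) : Measure ℝ :=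
  Measure.ofMeasurable (fun B _ => trace (CFC.sqrt ρ ∘L M.eff B ∘L CFC.sqrt ρ))
    (by
      simp only [trace, traceIn, inner_sqrt_sandwich, M.inner_empty]
      simp)
    (by
      intro B hB hd
      simp only [trace, traceIn, inner_sqrt_sandwich]
      rw [ENNReal.tsum_comm]
      refine tsum_congr fun i => ?_
      have h := Complex.hasSum_re (M.hasSum_eff B hB hd (CFC.sqrt ρ (basis H i)))
      rw [← h.tsum_eq, ENNReal.ofReal_tsum_of_nonneg _ h.summable]
      intro n
      exact (M.isPositive _ (hB n)).re_inner_nonneg_right _)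

end Hilbert

/-! ### The representation of `ℝ` on `L²(ℝ)` -/

/-- The normalised Lebesgue measure `dx / √(2π)`. -/
def nu : Measure ℝ := ENNReal.ofReal (1 / Real.sqrt (2 * Real.pi)) • volume

/-- The space `L²(ℝ, dλ/√(2π))` of wave functions of the weight `λ`. -/
abbrev WaveSpace : Type := Lp ℂ 2 nu

lemma memLp_char (g : ℝ) : MemLp (fun l : ℝ => Complex.exp (Complex.I * (l * g : ℝ))) ∞ nu := by
  refine memLp_top_of_bound (by fun_prop) 1 (Filter.Eventually.of_forall fun l => ?_)
  rw [mul_comm, Complex.norm_exp_ofReal_mul_I]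

/-- The unitary `f(g)` on `L²(ℝ)`: multiplication by the character `λ ↦ exp(iλg)`. -/
def rep (g : ℝ) : WaveSpace →L[ℂ] WaveSpace :=
  (ContinuousLinearMap.lsmul ℂ ℂ).holderL nu ∞ 2 2 ((memLp_char g).toLp _)

lemma rep_coeFn (g : ℝ) (φ : WaveSpace) :
    rep g φ =ᵐ[nu] fun l => Complex.exp (Complex.I * (l * g : ℝ)) * φ l := by
  have h := (ContinuousLinearMap.lsmul ℂ ℂ).coeFn_holder (r := 2) ((memLp_char g).toLp _) φ
  filter_upwards [h, (memLp_char g).coeFn_toLp] with l h1 h2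
  rw [rep, ContinuousLinearMap.holderL_apply_apply, h1, h2]
  rfl

/-- Covariance of a POVM: `f(g) M(B) f(g)† = M(g + B)`. -/
def POVM.IsCovariant (M : POVM WaveSpace) : Prop :=
  ∀ (g : ℝ) (B : Set ℝ), MeasurableSet B →
    rep g ∘L M.eff B ∘L ContinuousLinearMap.adjoint (rep g) = M.eff ((fun x => g + x) '' B)

/-- The mean square error `∫ (ĝ - g)² Tr f(g) ρ f(g)† M(dĝ)` at the true value `g`. -/
def errorAt (g : ℝ) (ρ : DensityOp WaveSpace) (M : POVM WaveSpace) : ℝ≥0∞ :=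
  ∫⁻ x, ENNReal.ofReal ((x - g) ^ 2)
    ∂(M.outcome (rep g ∘L ρ.op ∘L ContinuousLinearMap.adjoint (rep g)))

/-- The worst-case mean square error. -/
def worstError (ρ : DensityOp WaveSpace) (M : POVM WaveSpace) : ℝ≥0∞ := ⨆ g : ℝ, errorAt g ρ M

/-- `⟨φ|Q²|φ⟩ = ∫ λ² |φ(λ)|² dλ/√(2π)`, which is `∞` off the form domain. -/
def qSq (φ : WaveSpace) : ℝ≥0∞ := ∫⁻ l, ENNReal.ofReal (l ^ 2 * ‖φ l‖ ^ 2) ∂nu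

/-- The energy `Tr ρ Q² = Tr √ρ Q² √ρ`. -/
def energy (ρ : DensityOp WaveSpace) : ℝ≥0∞ :=
  traceForm ρ.op qSq

/-! ### Fourier transform and momentum -/

lemma volume_le_nu : volume ≤ (ENNReal.ofReal (Real.sqrt (2 * Real.pi))) • nu := by
  have h : (0 : ℝ) < Real.sqrt (2 * Real.pi) := by positivity
  rw [nu, smul_smul, ← ENNReal.ofReal_mul h.le, mul_one_div_cancel h.ne', ENNReal.ofReal_one,
    one_smul]

lemma memLp_volume (φ : WaveSpace) : MemLp φ 2 (volume : Measure ℝ) :=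
  (Lp.memLp φ).of_measure_le_smul ENNReal.ofReal_ne_top volume_le_nu

/-- The inverse Fourier transform `F⁻¹[φ](g) = ∫ exp(-iλg) φ(λ) dλ/√(2π)`, extended to `L²(ℝ)`
by Plancherel. Mathlib's transform on `L²` is `𝓕 φ (w) = ∫ exp(-2πiλw) φ(λ) dλ`. -/
def invFourier (φ : WaveSpace) : ℝ → ℂ := fun g =>
  (1 / Real.sqrt (2 * Real.pi) : ℝ) *
    (𝓕 ((memLp_volume φ).toLp φ) : Lp ℂ 2 (volume : Measure ℝ)) (g / (2 * Real.pi))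

/-- The mean square error `∫ ĝ² |F⁻¹[φ](ĝ)|² dĝ/√(2π)`. -/
def fourierError (φ : WaveSpace) : ℝ≥0∞ :=
  ∫⁻ x, ENNReal.ofReal (x ^ 2 * ‖invFourier φ x‖ ^ 2) ∂nu

/-- `ψ = P φ` for the momentum operator `P = -i d/dλ`, in the sense of weak derivatives. -/
def IsMomentum (φ ψ : WaveSpace) : Prop :=
  ∀ η : ℝ → ℂ, ContDiff ℝ ∞ η → HasCompactSupport η →
    ∫ l, ψ l * η l ∂nu = Complex.I * ∫ l, φ l * deriv η l ∂nu

/-- `⟨φ|P²|φ⟩ = ‖P φ‖²`, which is `∞` if `φ` is not in the domain of `P`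
(there is at most one `ψ` with `ψ = P φ`). -/
def pSq (φ : WaveSpace) : ℝ≥0∞ :=
  ⨅ (ψ : WaveSpace) (_ : IsMomentum φ ψ), ENNReal.ofReal (‖ψ‖ ^ 2)

/-- The Gaussian `E^{-1/4} exp(-λ²/(4E))`. -/
def gaussian (E : ℝ) (l : ℝ) : ℝ := E ^ (-(1 / 4) : ℝ) * Real.exp (-l ^ 2 / (4 * E))

end RealShift

end

open RealShift

set_option linter.unusedSectionVars false

open RealShift

/-! The proof replaces the constrained problem by a linear one. For a covariant measurement `M` and
a vector `x`, the `cost` of `x` is the energy weighted by 1/(2E) plus the second moment of the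
outcome weighted by 2E. The uncertainty relation `norm_sq_le_cost` bounds it below by ‖x‖². At
energy E and error 1/(4E) both terms equal 1/2 for a unit vector, so this bound gives the minimum.
Since the cost is additive, the bound passes to mixed states (sum over the vectors √ρ eᵢ) and to
random mixtures of schemes, so neither mixing nor randomisation helps.

The uncertainty relation needs neither a dilation of `M` nor a classification of covariant
measurements. If the outcome has a second moment at `x`, Kadison–Schwarz makes the first moment X =
(∫ y M(dy)) x a vector with ‖X‖² at most that second moment (`POVM.exists_moment`). Covariance gives
a Weyl relation between X and the shifts of `x` (`inner_moment_rep`), and its derivative at 0 is 2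
Im⟨Qx|X⟩ = ‖x‖². Completing the square finishes the argument.

In the equality case X = (i/2E) Qx. The Weyl relation then becomes a differential equation for the
characteristic function of |x|², with a Gaussian as its solution (`norm_sq_eq_of_cost_le`). For
fixed `M` the equality cases form a subspace by the parallelogram law. All its members have modulus
proportional to the same Gaussian, so polarisation leaves at most a line
(`exists_eq_smul_of_cost_le`). Optimal states are therefore pure.

For the Fourier measurement this line is spanned by φ_E itself. A phase in the input can be undone
by a multiplication operator, which commutes with the shifts, so every Gaussian up to phase is
optimal for some covariant measurement. The momentum problem reduces to the Fourier problem because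
the transform turns P into multiplication. -/

namespace RealShift

/-! ### Outcome distributions of a POVM and its first moment. -/

section Hilbert

variable {H : Type*} [NormedAddCommGroup H] [InnerProductSpace ℂ H] [CompleteSpace H]

namespace POVM

/-- The distribution `B ↦ ⟨x|M(B)|x⟩` of the outcome of `M` at the vector `x`. -/
noncomputable def dist (M : POVM H) (x : H) : Measure ℝ :=
  Measure.ofMeasurable (fun B _ => ENNReal.ofReal (⟪x, M.eff B x⟫_ℂ).re)
    (by simp [M.inner_empty])
    (by
      intro B hB hd
      have h := Complex.hasSum_re (M.hasSum_eff B hB hd x)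
      rw [← h.tsum_eq, ENNReal.ofReal_tsum_of_nonneg _ h.summable]
      exact fun n => (M.isPositive _ (hB n)).re_inner_nonneg_right _)

lemma dist_apply (M : POVM H) (x : H) {B : Set ℝ} (hB : MeasurableSet B) :
    M.dist x B = ENNReal.ofReal (⟪x, M.eff B x⟫_ℂ).re :=
  Measure.ofMeasurable_apply _ hB

lemma dist_univ (M : POVM H) (x : H) : M.dist x Set.univ = ENNReal.ofReal (‖x‖ ^ 2) := by
  rw [dist_apply _ _ MeasurableSet.univ, M.eff_univ, one_apply_eq_self,
    inner_self_eq_norm_sq_to_K]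
  norm_cast

instance (M : POVM H) (x : H) : IsFiniteMeasure (M.dist x) :=
  ⟨by rw [dist_univ]; exact ENNReal.ofReal_lt_top⟩

/-- This decomposition reduces statements on mixed states to statements on the unnormalised vectors
√ρ eᵢ. -/
lemma outcome_eq_sum (M : POVM H) (ρ : H →L[ℂ] H) :
    M.outcome ρ = Measure.sum fun i => M.dist (CFC.sqrt ρ (basis H i)) := by
  ext B hB
  rw [outcome, Measure.ofMeasurable_apply _ hB, Measure.sum_apply _ hB]
  simp only [trace, traceIn, inner_sqrt_sandwich, dist_apply _ _ hB]

lemma inner_eff_self (M : POVM H) (x : H) {B : Set ℝ} (hB : MeasurableSet B) :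
    ⟪x, M.eff B x⟫_ℂ = ((M.dist x).real B : ℂ) := by
  rw [measureReal_def, dist_apply _ _ hB,
    ENNReal.toReal_ofReal (show 0 ≤ (⟪x, M.eff B x⟫_ℂ).re from
      (M.isPositive _ hB).re_inner_nonneg_right _)]
  have h := (M.isPositive _ hB).inner_nonneg_right x
  rw [Complex.nonneg_iff] at h
  apply Complex.ext <;> simp [h.2.symm]

lemma eff_comm (M : POVM H) {B : Set ℝ} (hB : MeasurableSet B) (x y : H) :
    ⟪M.eff B x, y⟫_ℂ = ⟪x, M.eff B y⟫_ℂ :=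
  (M.isPositive _ hB).isSymmetric x y

/-- The axioms give additivity only for diagonal matrix elements; polarisation on a complex space
lifts it to operators. -/
lemma eff_union (M : POVM H) {B C : Set ℝ} (hB : MeasurableSet B) (hC : MeasurableSet C)
    (h : Disjoint B C) : M.eff (B ∪ C) = M.eff B + M.eff C := by
  refine ContinuousLinearMap.coe_injective ((ext_inner_map _ _).1 fun x => ?_)
  have e : ∀ D, MeasurableSet D → ⟪M.eff D x, x⟫_ℂ = ((M.dist x).real D : ℂ) := fun D hD => by
    rw [eff_comm _ hD, inner_eff_self _ _ hD]
  simp only [ContinuousLinearMap.coe_coe, add_apply, inner_add_left,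
    e _ hB, e _ hC, e _ (hB.union hC)]
  rw [measureReal_union h hC]
  push_cast
  rfl

/-- The effects as additive functions with values in the real linear maps. -/
noncomputable def effSMul (M : POVM H) (B : Set ℝ) : ℝ →L[ℝ] (H →L[ℂ] H) :=
  (ContinuousLinearMap.id ℝ ℝ).smulRight (M.eff B)

lemma effSMul_apply (M : POVM H) (B : Set ℝ) (c : ℝ) : M.effSMul B c = c • M.eff B := rfl

/-- With the zero measure the finiteness conditions in `FinMeasAdditive` are empty, so the
`setToSimpleFunc` calculus applies to all simple functions. -/
lemma finMeasAdditive_effSMul (M : POVM H) : FinMeasAdditive (0 : Measure ℝ) M.effSMul := by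
  intro B C hB hC _ _ h
  ext1
  simp [effSMul_apply, M.eff_union hB hC h]

/-- The integral `∫ t dM` of a simple function. -/
noncomputable def sInt (M : POVM H) (t : SimpleFunc ℝ ℝ) : H →L[ℂ] H :=
  t.setToSimpleFunc M.effSMul

lemma sInt_apply (M : POVM H) (t : SimpleFunc ℝ ℝ) (x : H) :
    M.sInt t x = ∑ c ∈ t.range, c • M.eff (t ⁻¹' {c}) x := by
  simp [sInt, SimpleFunc.setToSimpleFunc, effSMul_apply]

lemma sInt_sub (M : POVM H) (t u : SimpleFunc ℝ ℝ) : M.sInt (t - u) = M.sInt t - M.sInt u :=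
  SimpleFunc.setToSimpleFunc_sub _ M.finMeasAdditive_effSMul integrable_zero_measure
    integrable_zero_measure

lemma eff_empty (M : POVM H) : M.eff ∅ = 0 := by
  have h := M.eff_union MeasurableSet.empty MeasurableSet.empty (Set.disjoint_empty ∅)
  simpa using h

lemma sInt_const (M : POVM H) (c : ℝ) : M.sInt (SimpleFunc.const ℝ c) = c • 1 := by
  rw [sInt, SimpleFunc.setToSimpleFunc_const _ (by ext1; simp [effSMul_apply, eff_empty]),
    effSMul_apply, eff_univ]

lemma sInt_zero (M : POVM H) : M.sInt 0 = 0 :=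
  (M.sInt_const 0).trans (zero_smul ℝ _)

lemma sInt_comm (M : POVM H) (t : SimpleFunc ℝ ℝ) (x y : H) :
    ⟪M.sInt t x, y⟫_ℂ = ⟪x, M.sInt t y⟫_ℂ := by
  simp only [sInt_apply, sum_inner, inner_sum]
  refine Finset.sum_congr rfl fun c _ => ?_
  rw [← Complex.coe_smul, ← Complex.coe_smul, inner_smul_left, inner_smul_right,
    eff_comm _ (t.measurableSet_fiber c)]
  simp

lemma sum_eff_fiber (M : POVM H) (t : SimpleFunc ℝ ℝ) (x : H) :
    ∑ c ∈ t.range, M.eff (t ⁻¹' {c}) x = x := by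
  have h := FinMeasAdditive.map_iUnion_fin_meas_set_eq_sum M.effSMul
    (by ext1; simp [effSMul_apply, eff_empty]) M.finMeasAdditive_effSMul
    (fun c => t ⁻¹' {c}) t.range (fun c => t.measurableSet_fiber c) (fun _ _ => by simp)
    (fun c _ d _ hcd => Disjoint.preimage _ (by simpa using hcd))
  have e : ⋃ c ∈ t.range, t ⁻¹' {c} = Set.univ := by
    ext y
    simp
  rw [e] at h
  have h2 := congrArg (fun T => T 1 x) h
  simp only [_root_.sum_apply, effSMul_apply, one_smul, eff_univ, one_apply_eq_self] at h2
  exact h2.symm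

/-- The Kadison–Schwarz inequality for the integral of a simple function. -/
lemma norm_sInt_sq_le (M : POVM H) (t : SimpleFunc ℝ ℝ) (x : H) :
    ‖M.sInt t x‖ ^ 2 ≤ ∑ c ∈ t.range, c ^ 2 * (M.dist x).real (t ⁻¹' {c}) := by
  set v := M.sInt t x with hv
  -- A variance argument: the effects are positive at the deviations c x − v. After expansion, both
  -- ∑⟨v|c M_c x⟩ and ∑⟨v|M_c v⟩ equal ‖v‖², because the effects add up to 1.
  have h0 : 0 ≤ ∑ c ∈ t.range, (⟪c • x - v, M.eff (t ⁻¹' {c}) (c • x - v)⟫_ℂ).re :=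
    Finset.sum_nonneg fun c _ => (M.isPositive _ (t.measurableSet_fiber c)).re_inner_nonneg_right _
  have e : ∀ c : ℝ, (⟪c • x - v, M.eff (t ⁻¹' {c}) (c • x - v)⟫_ℂ).re =
      c ^ 2 * (M.dist x).real (t ⁻¹' {c}) - 2 * (⟪v, c • M.eff (t ⁻¹' {c}) x⟫_ℂ).re
        + (⟪v, M.eff (t ⁻¹' {c}) v⟫_ℂ).re := by
    intro c
    have hB := t.measurableSet_fiber c
    have h2 : (⟪x, M.eff (t ⁻¹' {c}) v⟫_ℂ).re = (⟪v, M.eff (t ⁻¹' {c}) x⟫_ℂ).re := by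
      rw [← M.eff_comm hB, ← inner_conj_symm, Complex.conj_re]
    simp only [← Complex.coe_smul, map_sub, map_smul, inner_sub_left, inner_sub_right,
      inner_smul_left, inner_smul_right, inner_eff_self _ _ hB, Complex.conj_ofReal]
    simp [h2]
    ring
  simp only [e, Finset.sum_add_distrib, Finset.sum_sub_distrib, ← Finset.mul_sum,
    ← Complex.re_sum, ← inner_sum, sum_eff_fiber, ← sInt_apply, ← hv] at h0
  have hvv : (⟪v, v⟫_ℂ).re = ‖v‖ ^ 2 := by
    rw [inner_self_eq_norm_sq_to_K]; norm_cast
  rw [hvv] at h0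
  linarith

/-- Kadison–Schwarz as a contraction from L² of the outcome distribution at `x`, the form that
extends to limits of simple functions. -/
lemma enorm_sInt_le (M : POVM H) (t : SimpleFunc ℝ ℝ) (x : H) :
    ‖M.sInt t x‖ₑ ≤ eLpNorm t 2 (M.dist x) := by
  have h1 : eLpNorm t 2 (M.dist x) ^ 2 = ∫⁻ y, ‖t y‖ₑ ^ 2 ∂(M.dist x) := by
    have := eLpNorm_nnreal_pow_eq_lintegral (f := t) (μ := M.dist x) (p := 2) (by norm_num)
    simpa using this
  have h2 : ∫⁻ y, ‖t y‖ₑ ^ 2 ∂(M.dist x) =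
      ENNReal.ofReal (∑ c ∈ t.range, c ^ 2 * (M.dist x).real (t ⁻¹' {c})) := by
    have e := (t.map fun c => ‖c‖ₑ ^ 2).lintegral_eq_lintegral (M.dist x)
    rw [SimpleFunc.map_lintegral] at e
    simp only [SimpleFunc.coe_map, Function.comp_def] at e
    rw [e, ENNReal.ofReal_sum_of_nonneg fun _ _ => by positivity]
    refine Finset.sum_congr rfl fun c _ => ?_
    rw [ENNReal.ofReal_mul (by positivity), measureReal_def,
      ENNReal.ofReal_toReal (measure_ne_top _ _), ← sq_abs, ENNReal.ofReal_pow (abs_nonneg c),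
      ← Real.norm_eq_abs, ofReal_norm]
  rw [← ENNReal.pow_le_pow_left_iff (n := 2) two_ne_zero, h1, h2, ← ofReal_norm,
    ← ENNReal.ofReal_pow (norm_nonneg _)]
  exact ENNReal.ofReal_le_ofReal (M.norm_sInt_sq_le t x)

/-- If the outcome distribution at `x` has a second moment, then `(∫ y M(dy)) x` exists. -/
lemma exists_moment (M : POVM H) (x : H) (hx : MemLp (fun y : ℝ => y) 2 (M.dist x)) :
    ∃ X : H, ∀ t : SimpleFunc ℝ ℝ,
      ‖M.sInt t x - X‖ₑ ≤ eLpNorm (fun y => t y - y) 2 (M.dist x) := by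
  -- Simple functions within 2⁻ⁿ of the identity in L². The contraction makes their integrals at `x`
  -- a Cauchy sequence, whose limit is X.
  have h0 : ∀ n : ℕ, ∃ t : SimpleFunc ℝ ℝ,
      eLpNorm (fun y => y - t y) 2 (M.dist x) < (2⁻¹ : ℝ≥0∞) ^ n ∧ MemLp t 2 (M.dist x) :=
    fun n => hx.exists_simpleFunc_eLpNorm_sub_lt (by simp) (by simp)
  choose t ht _ using h0
  have hmeas : ∀ u : SimpleFunc ℝ ℝ,
      AEStronglyMeasurable (fun y => u y - y) (M.dist x) := fun u =>
    (u.measurable.sub measurable_id).aestronglyMeasurable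
  have hd : ∀ (u : SimpleFunc ℝ ℝ) n, ‖M.sInt u x - M.sInt (t n) x‖ₑ ≤
      eLpNorm (fun y => u y - y) 2 (M.dist x) + (2⁻¹ : ℝ≥0∞) ^ n := by
    intro u n
    have e : M.sInt u x - M.sInt (t n) x = M.sInt (u - t n) x := by rw [sInt_sub]; rfl
    have e2 : ⇑(u - t n) = (fun y => u y - y) + fun y => y - t n y := by
      ext y
      simp
    rw [e]
    refine (M.enorm_sInt_le _ x).trans ?_
    rw [e2]
    refine (eLpNorm_add_le (hmeas u) ?_ (by norm_num)).trans (add_le_add le_rfl (ht n).le)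
    exact (measurable_id.sub (t n).measurable).aestronglyMeasurable
  have hc : CauchySeq fun n => M.sInt (t n) x := by
    refine cauchySeq_of_edist_le_of_tsum_ne_top (fun n => 2 * (2⁻¹ : ℝ≥0∞) ^ n) ?_ ?_
    · intro n
      rw [edist_comm, edist_eq_enorm_sub]
      refine (hd (t n.succ) n).trans ?_
      rw [two_mul]
      gcongr
      rw [← eLpNorm_neg]
      have e : (-fun y => t n.succ y - y) = fun y => y - t n.succ y := by
        ext y
        simp
      rw [e]
      refine (ht n.succ).le.trans ?_
      exact pow_le_pow_right_of_le_one' (by simp) n.le_succ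
    · rw [ENNReal.tsum_mul_left, ENNReal.tsum_geometric]
      simp [ENNReal.mul_eq_top]
  obtain ⟨X, hX⟩ := cauchySeq_tendsto_of_complete hc
  refine ⟨X, fun u => ?_⟩
  have l1 : Filter.Tendsto (fun n => ‖M.sInt u x - M.sInt (t n) x‖ₑ) Filter.atTop
      (nhds ‖M.sInt u x - X‖ₑ) := (tendsto_const_nhds.sub hX).enorm
  have l2 : Filter.Tendsto (fun n => eLpNorm (fun y => u y - y) 2 (M.dist x) + (2⁻¹ : ℝ≥0∞) ^ n)
      Filter.atTop (nhds (eLpNorm (fun y => u y - y) 2 (M.dist x) + 0)) :=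
    tendsto_const_nhds.add (ENNReal.tendsto_pow_atTop_nhds_zero_of_lt_one (by simp))
  rw [add_zero] at l2
  exact le_of_tendsto_of_tendsto' l1 l2 (hd u)

end POVM

end Hilbert

/-! ### The shift representation and the first moment of a covariant measurement. -/

lemma WaveSpace.inner_eq (x y : WaveSpace) :
    ⟪x, y⟫_ℂ = ∫ l, y l * (starRingEnd ℂ) (x l) ∂nu := by
  rw [L2.inner_def]
  rfl

lemma rep_rep (g h : ℝ) (x : WaveSpace) : rep g (rep h x) = rep (g + h) x := by
  apply Lp.ext
  filter_upwards [rep_coeFn g (rep h x), rep_coeFn h x, rep_coeFn (g + h) x] with l h1 h2 h3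
  rw [h1, h2, h3, ← mul_assoc, ← Complex.exp_add]
  push_cast
  ring_nf

lemma rep_zero (x : WaveSpace) : rep 0 x = x := by
  apply Lp.ext
  filter_upwards [rep_coeFn 0 x] with l h1
  simp [h1]

lemma conj_char (l s : ℝ) : (starRingEnd ℂ) (Complex.exp (Complex.I * (l * s : ℝ))) =
    Complex.exp (Complex.I * (l * -s : ℝ)) := by
  rw [← Complex.exp_conj, map_mul, Complex.conj_I, Complex.conj_ofReal]
  push_cast
  ring_nf

lemma inner_rep_left (s : ℝ) (x y : WaveSpace) : ⟪rep s x, y⟫_ℂ = ⟪x, rep (-s) y⟫_ℂ := by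
  rw [WaveSpace.inner_eq, WaveSpace.inner_eq]
  refine integral_congr_ae ?_
  filter_upwards [rep_coeFn s x, rep_coeFn (-s) y] with l h1 h2
  rw [h1, h2, map_mul, conj_char]
  ring

lemma adjoint_rep (s : ℝ) : ContinuousLinearMap.adjoint (rep s) = rep (-s) := by
  symm
  rw [ContinuousLinearMap.eq_adjoint_iff]
  intro x y
  rw [inner_rep_left, neg_neg]

lemma norm_rep (s : ℝ) (x : WaveSpace) : ‖rep s x‖ = ‖x‖ := by
  have h : ⟪rep s x, rep s x⟫_ℂ = ⟪x, x⟫_ℂ := by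
    rw [inner_rep_left, rep_rep, neg_add_cancel, rep_zero]
  rw [inner_self_eq_norm_sq_to_K, inner_self_eq_norm_sq_to_K] at h
  have h2 : ‖rep s x‖ ^ 2 = ‖x‖ ^ 2 := by exact_mod_cast h
  exact (pow_left_inj₀ (norm_nonneg _) (norm_nonneg _) two_ne_zero).1 h2

namespace POVM

variable {M : POVM WaveSpace}

lemma IsCovariant.eff_rep (hM : M.IsCovariant) (s : ℝ) {B : Set ℝ} (hB : MeasurableSet B)
    (x : WaveSpace) : M.eff B (rep s x) = rep s (M.eff ((fun y => y + s) ⁻¹' B) x) := by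
  have h := congrArg (fun T => T x) (hM (-s) B hB)
  have e : (fun y => -s + y) '' B = (fun y => y + s) ⁻¹' B := by
    ext y
    simp [add_comm]
  simp only [ContinuousLinearMap.comp_apply, adjoint_rep, neg_neg, e] at h
  rw [← h, rep_rep, add_neg_cancel, rep_zero]

lemma IsCovariant.dist_rep (hM : M.IsCovariant) (s : ℝ) (x : WaveSpace) :
    M.dist (rep s x) = (M.dist x).map fun y => y + s := by
  have hm : Measurable fun y : ℝ => y + s := by fun_prop
  ext B hB
  rw [Measure.map_apply hm hB, dist_apply _ _ hB, dist_apply _ _ (hm hB), hM.eff_rep s hB,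
    inner_rep_left, rep_rep, neg_add_cancel, rep_zero]

lemma IsCovariant.sInt_rep (hM : M.IsCovariant) (s : ℝ) (t : SimpleFunc ℝ ℝ) (x : WaveSpace) :
    M.sInt t (rep s x) =
      rep s (M.sInt (t.comp (fun y => y + s) (measurable_id.add_const s)) x) := by
  have e : (t.comp (fun y => y + s) (measurable_id.add_const s)).range = t.range := by
    ext c
    simp only [SimpleFunc.mem_range, SimpleFunc.coe_comp, Set.mem_range, Function.comp_apply]
    exact ⟨fun ⟨y, hy⟩ => ⟨y + s, hy⟩, fun ⟨y, hy⟩ => ⟨y - s, by simpa using hy⟩⟩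
  rw [sInt_apply, sInt_apply, e, map_sum]
  refine Finset.sum_congr rfl fun c _ => ?_
  rw [hM.eff_rep s (t.measurableSet_fiber c), ← Complex.coe_smul, ← Complex.coe_smul, map_smul]
  rfl

/-- The Weyl relation for the first moment of a covariant measurement. -/
lemma IsCovariant.inner_moment_rep (hM : M.IsCovariant) {x X : WaveSpace}
    (hx : MemLp (fun y : ℝ => y) 2 (M.dist x))
    (hX : ∀ t : SimpleFunc ℝ ℝ, ‖M.sInt t x - X‖ₑ ≤ eLpNorm (fun y => t y - y) 2 (M.dist x))
    (s : ℝ) : ⟪X, rep s x⟫_ℂ = ⟪rep (-s) x, X⟫_ℂ + s * ⟪rep (-s) x, x⟫_ℂ := by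
  have hm : Measurable fun y : ℝ => y + s := by fun_prop
  -- A single simple function has to approximate the identity for the outcome distribution and for
  -- its translate at once, hence the sum of the two measures.
  have hκ : MemLp (fun y : ℝ => y) 2 (M.dist x + (M.dist x).map fun y => y + s) := by
    have h2 : MemLp (fun y : ℝ => y) 2 ((M.dist x).map fun y => y + s) := by
      rw [memLp_map_measure_iff (by fun_prop) hm.aemeasurable]
      exact hx.add (memLp_const s)
    exact (memLp_two_iff_integrable_sq (by fun_prop)).2 (hx.integrable_sq.add_measure h2.integrable_sq)
  have key : ∀ ε : ℝ, 0 < ε →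
      ‖⟪X, rep s x⟫_ℂ - (⟪rep (-s) x, X⟫_ℂ + s * ⟪rep (-s) x, x⟫_ℂ)‖ ≤ ε * (2 * ‖x‖) := by
    intro ε hε
    obtain ⟨t, ht, -⟩ := hκ.exists_simpleFunc_eLpNorm_sub_lt (by simp)
      (ε := ENNReal.ofReal ε) (by simpa using hε)
    rw [← eLpNorm_neg] at ht
    have e1 : (-((fun y : ℝ => y) - ⇑t)) = fun y => t y - y := by
      ext y
      simp
    rw [e1] at ht
    -- Here u(y) − y = t(y + s) − (y + s), so `u` approximates the identity at `x` as well as `t`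
    -- does for the translate. For simple functions covariance gives the Weyl relation exactly, with
    -- `t` on one side and `u` on the other.
    set u := t.comp (fun y => y + s) (measurable_id.add_const s) - SimpleFunc.const ℝ s with hu
    have toReal : ∀ v : WaveSpace, ‖v‖ₑ ≤ ENNReal.ofReal ε → ‖v‖ ≤ ε := by
      intro v hv
      rw [← ofReal_norm] at hv
      exact (ENNReal.ofReal_le_ofReal_iff hε.le).1 hv
    have h1 : ‖M.sInt t x - X‖ ≤ ε := toReal _ <| (hX t).trans <|
      (eLpNorm_mono_measure _ (Measure.le_add_right le_rfl)).trans ht.le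
    have h2 : ‖M.sInt u x - X‖ ≤ ε := by
      refine toReal _ <| (hX u).trans <| le_trans ?_ <|
        (eLpNorm_mono_measure _ (Measure.le_add_left le_rfl)).trans ht.le
      rw [eLpNorm_map_measure (g := fun y => t y - y)
        (t.measurable.sub measurable_id).aestronglyMeasurable hm.aemeasurable]
      apply le_of_eq
      congr 1
      ext y
      simp [hu]
      ring
    have e2 : ⟪M.sInt t x, rep s x⟫_ℂ =
        ⟪rep (-s) x, M.sInt u x⟫_ℂ + s * ⟪rep (-s) x, x⟫_ℂ := by
      have : M.sInt u x = M.sInt (t.comp (fun y => y + s) (measurable_id.add_const s)) x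
          - (s : ℂ) • x := by
        rw [hu, sInt_sub, sInt_const, Complex.coe_smul]
        rfl
      rw [M.sInt_comm, hM.sInt_rep, this, inner_rep_left, neg_neg, inner_rep_left, neg_neg, map_sub,
        map_smul, inner_sub_right, inner_smul_right]
      ring
    have e3 : ⟪X, rep s x⟫_ℂ - (⟪rep (-s) x, X⟫_ℂ + s * ⟪rep (-s) x, x⟫_ℂ) =
        -⟪M.sInt t x - X, rep s x⟫_ℂ + ⟪rep (-s) x, M.sInt u x - X⟫_ℂ := by
      rw [inner_sub_left, inner_sub_right, e2]
      ring
    rw [e3]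
    refine (norm_add_le _ _).trans ?_
    have n1 := norm_inner_le_norm (𝕜 := ℂ) (M.sInt t x - X) (rep s x)
    have n2 := norm_inner_le_norm (𝕜 := ℂ) (rep (-s) x) (M.sInt u x - X)
    rw [norm_rep] at n1 n2
    rw [norm_neg]
    nlinarith [norm_nonneg x]
  rw [← sub_eq_zero, ← norm_eq_zero]
  refine le_antisymm (le_of_forall_pos_le_add fun δ hδ => ?_) (norm_nonneg _)
  have := key (δ / (2 * ‖x‖ + 1)) (by positivity)
  rw [zero_add]
  refine this.trans ?_
  rw [div_mul_eq_mul_div, div_le_iff₀ (by positivity)]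
  nlinarith [norm_nonneg x]

end POVM

/-! ### Position and the canonical commutation relation. -/

lemma norm_char (l s : ℝ) : ‖Complex.exp (Complex.I * (l * s : ℝ))‖ = 1 := by
  rw [mul_comm, Complex.norm_exp_ofReal_mul_I]

/-- Differentiation of a Fourier integral. -/
lemma hasDerivAt_integral_char {u : ℝ → ℂ} {μ : Measure ℝ} (hu : Integrable u μ)
    (hlu : Integrable (fun l : ℝ => (l : ℂ) * u l) μ) (s : ℝ) :
    HasDerivAt (fun s : ℝ => ∫ l : ℝ, Complex.exp (Complex.I * (l * s : ℝ)) * u l ∂μ)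
      (∫ l : ℝ, Complex.exp (Complex.I * (l * s : ℝ)) * (Complex.I * ((l : ℂ) * u l)) ∂μ) s := by
  have hc : ∀ s : ℝ, AEStronglyMeasurable
      (fun l : ℝ => Complex.exp (Complex.I * (l * s : ℝ))) μ := fun s =>
    Continuous.aestronglyMeasurable (by fun_prop)
  refine (hasDerivAt_integral_of_dominated_loc_of_deriv_le (bound := fun l : ℝ => ‖(l : ℂ) * u l‖)
    (F := fun (s l : ℝ) => Complex.exp (Complex.I * (l * s : ℝ)) * u l)
    (F' := fun (s l : ℝ) => Complex.exp (Complex.I * (l * s : ℝ)) * (Complex.I * ((l : ℂ) * u l)))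
    (Filter.univ_mem) (Filter.Eventually.of_forall fun s => (hc s).mul hu.1) ?_
    ((hc s).mul (hlu.1.const_mul _)) ?_ hlu.norm ?_).2
  · refine hu.norm.mono' ((hc s).mul hu.1) (Filter.Eventually.of_forall fun l => ?_)
    rw [norm_mul, norm_char, one_mul]
  · refine Filter.Eventually.of_forall fun l s _ => ?_
    rw [norm_mul, norm_char, norm_mul, Complex.norm_I, one_mul, one_mul]
  · refine Filter.Eventually.of_forall fun l s _ => ?_
    have h : HasDerivAt (fun s : ℝ => Complex.I * ((l * s : ℝ) : ℂ)) (Complex.I * (l * 1 : ℝ)) s :=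
      (((hasDerivAt_id s).const_mul l).ofReal_comp).const_mul _
    have h2 := (h.cexp).mul_const (u l)
    rw [mul_one, mul_assoc, mul_assoc] at h2
    exact h2


lemma WaveSpace.integrable_mul_conj (x y : WaveSpace) :
    Integrable (fun l => y l * (starRingEnd ℂ) (x l)) nu :=
  L2.integrable_inner (𝕜 := ℂ) x y

lemma memLp_mul_of_qSq {x : WaveSpace} (hx : qSq x ≠ ⊤) :
    MemLp (fun l : ℝ => (l : ℂ) * x l) 2 nu := by
  have hm : AEStronglyMeasurable (fun l : ℝ => (l : ℂ) * x l) nu :=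
    (Continuous.aestronglyMeasurable (by fun_prop)).mul (Lp.aestronglyMeasurable x)
  rw [memLp_two_iff_integrable_sq_norm hm]
  refine ⟨(hm.norm.pow 2), ?_⟩
  rw [hasFiniteIntegral_iff_ofReal (Filter.Eventually.of_forall fun l => by positivity)]
  have e : (fun l : ℝ => ENNReal.ofReal (‖(l : ℂ) * x l‖ ^ 2)) =
      fun l => ENNReal.ofReal (l ^ 2 * ‖x l‖ ^ 2) := by
    ext l
    rw [norm_mul, Complex.norm_real, mul_pow, Real.norm_eq_abs, sq_abs]
  rw [e]
  exact lt_top_iff_ne_top.2 hx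

/-- The position operator on its domain. -/
noncomputable def position (x : WaveSpace) (hx : qSq x ≠ ⊤) : WaveSpace :=
  (memLp_mul_of_qSq hx).toLp _

lemma position_coeFn (x : WaveSpace) (hx : qSq x ≠ ⊤) :
    position x hx =ᵐ[nu] fun l => (l : ℂ) * x l :=
  MemLp.coeFn_toLp _

lemma ofReal_norm_sq_eq_lintegral {μ : Measure ℝ} (x : Lp ℂ 2 μ) :
    ENNReal.ofReal (‖x‖ ^ 2) = ∫⁻ l, ENNReal.ofReal (‖x l‖ ^ 2) ∂μ := by
  have h1 : eLpNorm x 2 μ ^ 2 = ∫⁻ y, ‖x y‖ₑ ^ 2 ∂μ := by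
    have := eLpNorm_nnreal_pow_eq_lintegral (f := x) (μ := μ) (p := 2) (by norm_num)
    simpa using this
  rw [ENNReal.ofReal_pow (norm_nonneg _), ofReal_norm, Lp.enorm_def, h1]
  refine lintegral_congr fun l => ?_
  rw [ENNReal.ofReal_pow (norm_nonneg _), ofReal_norm]

lemma qSq_eq_norm_position (x : WaveSpace) (hx : qSq x ≠ ⊤) :
    qSq x = ENNReal.ofReal (‖position x hx‖ ^ 2) := by
  rw [ofReal_norm_sq_eq_lintegral, qSq]
  refine lintegral_congr_ae ?_
  filter_upwards [position_coeFn x hx] with l h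
  rw [h, norm_mul, Complex.norm_real, mul_pow, Real.norm_eq_abs, sq_abs]

/-- The second moment of the outcome distribution of `M` at the vector `x`. -/
noncomputable def POVM.secondMoment (M : POVM WaveSpace) (x : WaveSpace) : ℝ≥0∞ :=
  ∫⁻ y, ENNReal.ofReal (y ^ 2) ∂(M.dist x)

lemma POVM.eLpNorm_dist_sq (M : POVM WaveSpace) (x : WaveSpace) :
    eLpNorm (fun y : ℝ => y) 2 (M.dist x) ^ 2 = M.secondMoment x := by
  have := eLpNorm_nnreal_pow_eq_lintegral (f := fun y : ℝ => y) (μ := M.dist x) (p := 2)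
    (by norm_num)
  rw [secondMoment]
  have e : ∀ y : ℝ, ENNReal.ofReal (y ^ 2) = ‖y‖ₑ ^ 2 := fun y => by
    rw [← sq_abs, ENNReal.ofReal_pow (abs_nonneg _), ← Real.norm_eq_abs, ofReal_norm]
  simp only [e]
  simpa using this

/-- The first moment of a covariant measurement at a vector with finite second moment. -/
lemma POVM.IsCovariant.exists_moment_rep {M : POVM WaveSpace} (hM : M.IsCovariant) {x : WaveSpace}
    (hx : M.secondMoment x ≠ ⊤) :
    ∃ X : WaveSpace, ENNReal.ofReal (‖X‖ ^ 2) ≤ M.secondMoment x ∧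
      ∀ s : ℝ, ⟪X, rep s x⟫_ℂ = ⟪rep (-s) x, X⟫_ℂ + s * ⟪rep (-s) x, x⟫_ℂ := by
  have hL : MemLp (fun y : ℝ => y) 2 (M.dist x) := by
    refine ⟨Continuous.aestronglyMeasurable (by fun_prop), lt_top_iff_ne_top.2 fun h => hx ?_⟩
    rw [← M.eLpNorm_dist_sq, h]
    rfl
  obtain ⟨X, hX⟩ := M.exists_moment x hL
  refine ⟨X, ?_, hM.inner_moment_rep hL hX⟩
  -- At the simple function 0 the estimate for X reads ‖X‖ ≤ ‖id‖ in L² of the outcome distribution.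
  have h0 := hX 0
  have e2 : (fun y : ℝ => (0 : SimpleFunc ℝ ℝ) y - y) = -fun y => y := by
    ext y
    simp
  rw [M.sInt_zero, _root_.zero_apply, zero_sub, enorm_neg, e2, eLpNorm_neg] at h0
  rw [ENNReal.ofReal_pow (norm_nonneg _), ofReal_norm, ← M.eLpNorm_dist_sq]
  gcongr

lemma inner_rep_right_eq_integral (s : ℝ) (x y : WaveSpace) :
    ⟪x, rep s y⟫_ℂ =
      ∫ l : ℝ, Complex.exp (Complex.I * (l * s : ℝ)) * (y l * (starRingEnd ℂ) (x l)) ∂nu := by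
  rw [WaveSpace.inner_eq]
  refine integral_congr_ae ?_
  filter_upwards [rep_coeFn s y] with l h
  rw [h, mul_assoc]

lemma integrable_char_mul {u : ℝ → ℂ} {μ : Measure ℝ} (hu : Integrable u μ) (s : ℝ) :
    Integrable (fun l : ℝ => Complex.exp (Complex.I * (l * s : ℝ)) * u l) μ := by
  have hc : AEStronglyMeasurable (fun l : ℝ => Complex.exp (Complex.I * (l * s : ℝ))) μ :=
    Continuous.aestronglyMeasurable (by fun_prop)
  refine hu.norm.mono' (hc.mul hu.1) (Filter.Eventually.of_forall fun l => ?_)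
  rw [norm_mul, norm_char, one_mul]

section Weyl

variable {x X : WaveSpace} (hq : qSq x ≠ ⊤)
  (hX : ∀ s : ℝ, ⟪X, rep s x⟫_ℂ = ⟪rep (-s) x, X⟫_ℂ + s * ⟪rep (-s) x, x⟫_ℂ)

-- The Weyl relation rewritten with Fourier integrals in the weight variable, where it can be
-- differentiated under the integral sign.
include hX in
lemma weyl_integral (s : ℝ) :
    ∫ l : ℝ, Complex.exp (Complex.I * (l * s : ℝ)) *
      (x l * (starRingEnd ℂ) (X l) - X l * (starRingEnd ℂ) (x l)) ∂nu = s * ⟪x, rep s x⟫_ℂ := by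
  have h := hX s
  rw [inner_rep_left, inner_rep_left, neg_neg] at h
  simp only [mul_sub]
  rw [integral_sub (integrable_char_mul (X.integrable_mul_conj x) s)
    (integrable_char_mul (x.integrable_mul_conj X) s), ← inner_rep_right_eq_integral,
    ← inner_rep_right_eq_integral, h]
  ring

lemma integrable_position_mul_conj (hq : qSq x ≠ ⊤) (y : WaveSpace) :
    Integrable (fun l : ℝ => (l : ℂ) * (x l * (starRingEnd ℂ) (y l))) nu := by
  refine (y.integrable_mul_conj (position x hq)).congr ?_
  filter_upwards [position_coeFn x hq] with l h
  rw [h, mul_assoc]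

lemma integrable_mul_conj_position (hq : qSq x ≠ ⊤) (y : WaveSpace) :
    Integrable (fun l : ℝ => (l : ℂ) * (y l * (starRingEnd ℂ) (x l))) nu := by
  refine ((position x hq).integrable_mul_conj y).congr ?_
  filter_upwards [position_coeFn x hq] with l h
  rw [h, map_mul, Complex.conj_ofReal]
  ring

lemma hasDerivAt_inner_rep (hq : qSq x ≠ ⊤) (s : ℝ) :
    HasDerivAt (fun s : ℝ => ⟪x, rep s x⟫_ℂ)
      (∫ l : ℝ, Complex.exp (Complex.I * (l * s : ℝ)) *
        (Complex.I * ((l : ℂ) * (x l * (starRingEnd ℂ) (x l)))) ∂nu) s := by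
  simp only [inner_rep_right_eq_integral]
  exact hasDerivAt_integral_char (x.integrable_mul_conj x) (integrable_position_mul_conj hq x) s

include hX in
/-- The canonical commutation relation in the weak form `2 Im ⟨Qx|X⟩ = ‖x‖²`. -/
lemma two_mul_im_inner_position : 2 * (⟪position x hq, X⟫_ℂ).im = ‖x‖ ^ 2 := by
  -- Both sides of `weyl_integral` are differentiated at 0. Only `x` has to lie in the domain of Q:
  -- l·x(l) and X are square integrable, so their product is integrable.
  have h1 := hasDerivAt_integral_char ((X.integrable_mul_conj x).sub (x.integrable_mul_conj X))
    (by
      simp only [Pi.sub_apply, mul_sub]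
      exact (integrable_position_mul_conj hq X).sub (integrable_mul_conj_position hq X)) 0
  simp only [Pi.sub_apply, weyl_integral hX] at h1
  have h2 : HasDerivAt (fun s : ℝ => (s : ℂ) * ⟪x, rep s x⟫_ℂ) _ 0 :=
    (Complex.ofRealCLM.hasDerivAt (x := (0 : ℝ))).mul (hasDerivAt_inner_rep hq 0)
  have h3 := h1.unique h2
  have e1 : ⟪position x hq, X⟫_ℂ = ∫ l : ℝ, (l : ℂ) * (X l * (starRingEnd ℂ) (x l)) ∂nu := by
    rw [WaveSpace.inner_eq]
    refine integral_congr_ae ?_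
    filter_upwards [position_coeFn x hq] with l h
    rw [h, map_mul, Complex.conj_ofReal]
    ring
  have e2 : ⟪X, position x hq⟫_ℂ = ∫ l : ℝ, (l : ℂ) * (x l * (starRingEnd ℂ) (X l)) ∂nu := by
    rw [WaveSpace.inner_eq]
    refine integral_congr_ae ?_
    filter_upwards [position_coeFn x hq] with l h
    rw [h, mul_assoc]
  simp only [mul_zero, Complex.ofReal_zero, Complex.exp_zero, one_mul, mul_sub,
    Complex.ofRealCLM_apply, zero_mul, add_zero, rep_zero, Complex.ofReal_one] at h3
  rw [integral_sub ((integrable_position_mul_conj hq X).const_mul _)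
    ((integrable_mul_conj_position hq X).const_mul _), integral_const_mul, integral_const_mul,
    ← e1, ← e2, inner_self_eq_norm_sq_to_K, ← inner_conj_symm X] at h3
  have h4 : _ = ((‖x‖ : ℂ) ^ 2).re := congrArg Complex.re h3
  rw [← Complex.ofReal_pow] at h4
  simp only [Complex.sub_re, Complex.I_mul_re, Complex.conj_im, Complex.ofReal_re] at h4
  linarith

end Weyl

/-! ### The uncertainty relation for covariant measurements. -/

/-- The quadratic form of the oscillator `Q²/(2E) + 2E·(mean square error of M)`. -/
noncomputable def cost (E : ℝ) (M : POVM WaveSpace) (x : WaveSpace) : ℝ≥0∞ :=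
  ENNReal.ofReal (1 / (2 * E)) * qSq x + ENNReal.ofReal (2 * E) * M.secondMoment x

lemma cost_ne_top {E : ℝ} (hE : 0 < E) {M : POVM WaveSpace} {x : WaveSpace} (h : cost E M x ≠ ⊤) :
    qSq x ≠ ⊤ ∧ M.secondMoment x ≠ ⊤ := by
  constructor <;>
  · intro h2
    apply h
    rw [cost, h2, ENNReal.mul_top (by simp [hE])]
    simp

/-- Completing the square: the cross term of Qx/(2E) and iX is −‖x‖² by the commutation relation.
The vector in the norm plays the part of the annihilation operator applied to `x`. The only loss is
that of replacing ‖X‖² by the second moment. -/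
lemma exists_moment_cost {E : ℝ} (hE : 0 < E) {M : POVM WaveSpace} (hM : M.IsCovariant)
    {x : WaveSpace} (hq : qSq x ≠ ⊤) (hm : M.secondMoment x ≠ ⊤) :
    ∃ X : WaveSpace, ENNReal.ofReal (‖x‖ ^ 2 + 2 * E *
        ‖((1 / (2 * E) : ℝ) : ℂ) • position x hq + Complex.I • X‖ ^ 2) ≤ cost E M x ∧
      ∀ s : ℝ, ⟪X, rep s x⟫_ℂ = ⟪rep (-s) x, X⟫_ℂ + s * ⟪rep (-s) x, x⟫_ℂ := by
  obtain ⟨X, h1, h2⟩ := hM.exists_moment_rep hm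
  refine ⟨X, ?_, h2⟩
  have h3 := two_mul_im_inner_position hq h2
  have h4 : ‖x‖ ^ 2 + 2 * E * ‖((1 / (2 * E) : ℝ) : ℂ) • position x hq + Complex.I • X‖ ^ 2 =
      1 / (2 * E) * ‖position x hq‖ ^ 2 + 2 * E * ‖X‖ ^ 2 := by
    have := @norm_add_sq ℂ _ _ _ _ (((1 / (2 * E) : ℝ) : ℂ) • position x hq) (Complex.I • X)
    rw [this, norm_smul, norm_smul, Complex.norm_I, inner_smul_left, inner_smul_right,
      Complex.conj_ofReal, Complex.norm_real, Real.norm_of_nonneg (by positivity), ← h3]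
    simp only [RCLike.re_eq_complex_re, Complex.re_ofReal_mul, Complex.I_mul_re]
    field_simp
    ring
  rw [h4, cost, ENNReal.ofReal_add (by positivity) (by positivity),
    ENNReal.ofReal_mul (by positivity), ENNReal.ofReal_mul (by positivity),
    ← qSq_eq_norm_position]
  gcongr

/-- The uncertainty relation for covariant measurements. -/
theorem norm_sq_le_cost {E : ℝ} (hE : 0 < E) {M : POVM WaveSpace} (hM : M.IsCovariant)
    (x : WaveSpace) : ENNReal.ofReal (‖x‖ ^ 2) ≤ cost E M x := by
  by_cases h : cost E M x = ⊤
  · rw [h]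
    exact le_top
  obtain ⟨hq, hm⟩ := cost_ne_top hE h
  obtain ⟨X, h1, -⟩ := exists_moment_cost hE hM hq hm
  refine le_trans (ENNReal.ofReal_le_ofReal ?_) h1
  have : 0 ≤ 2 * E * ‖((1 / (2 * E) : ℝ) : ℂ) • position x hq + Complex.I • X‖ ^ 2 := by positivity
  linarith

/-- Equality annihilates the square, so X = (i/2E) Qx. Substituted into the Weyl relation this gives
f′(s) = −E s f(s) for f(s) = ⟨x|f(s)x⟩, and the factor exp(E s²/2) integrates it. -/
lemma inner_rep_of_cost_le {E : ℝ} (hE : 0 < E) {M : POVM WaveSpace} (hM : M.IsCovariant)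
    {x : WaveSpace} (h : cost E M x ≤ ENNReal.ofReal (‖x‖ ^ 2)) (s : ℝ) :
    ⟪x, rep s x⟫_ℂ = ‖x‖ ^ 2 * Complex.exp (-(E * s ^ 2 / 2 : ℝ)) := by
  obtain ⟨hq, hm⟩ := cost_ne_top hE (ne_top_of_le_ne_top ENNReal.ofReal_ne_top h)
  obtain ⟨X, h1, h2⟩ := exists_moment_cost hE hM hq hm
  have h3 := (ENNReal.ofReal_le_ofReal_iff (by positivity)).1 (h1.trans h)
  set V := ((1 / (2 * E) : ℝ) : ℂ) • position x hq + Complex.I • X with hV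
  have h4 : V = 0 := by
    have : ‖V‖ ^ 2 ≤ 0 := by nlinarith [sq_nonneg ‖V‖]
    simpa using this
  have h5 : X = (Complex.I * (1 / (2 * E) : ℝ)) • position x hq := by
    have := congrArg (fun v => Complex.I • v) h4
    simp only [hV, smul_add, smul_smul, Complex.I_mul_I, neg_smul, one_smul, smul_zero] at this
    exact (add_neg_eq_zero.1 this).symm
  have h6 : ∀ s : ℝ, HasDerivAt (fun s : ℝ => ⟪x, rep s x⟫_ℂ) (-E * s * ⟪x, rep s x⟫_ℂ) s := by
    intro s
    convert hasDerivAt_inner_rep hq s using 1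
    rw [mul_assoc, ← weyl_integral h2, ← integral_const_mul]
    refine integral_congr_ae ?_
    rw [h5]
    filter_upwards [position_coeFn x hq,
      Lp.coeFn_smul (Complex.I * (1 / (2 * E) : ℝ)) (position x hq)] with l e1 e2
    rw [e2, Pi.smul_apply, e1]
    have : (E : ℂ) ≠ 0 := by exact_mod_cast hE.ne'
    simp only [smul_eq_mul, map_mul, Complex.conj_I, Complex.conj_ofReal]
    push_cast
    field_simp
    ring
  have h7 : ∀ s : ℝ, HasDerivAt
      (fun s : ℝ => ⟪x, rep s x⟫_ℂ * Complex.exp ((E * s ^ 2 / 2 : ℝ) : ℂ)) 0 s := by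
    intro s
    have d : HasDerivAt (fun s : ℝ => ((E * s ^ 2 / 2 : ℝ) : ℂ)) ((E * s : ℝ) : ℂ) s := by
      refine HasDerivAt.ofReal_comp ?_
      exact (((hasDerivAt_pow 2 s).const_mul E).div_const 2).congr_deriv (by norm_num; ring)
    exact ((h6 s).mul d.cexp).congr_deriv (by push_cast; ring)
  have h8 := is_const_of_deriv_eq_zero (fun s => (h7 s).differentiableAt) (fun s => (h7 s).deriv) s 0
  simp only [rep_zero, inner_self_eq_norm_sq_to_K] at h8
  rw [Complex.exp_neg, ← div_eq_mul_inv, eq_div_iff (Complex.exp_ne_zero _), h8]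
  simp

/-! ### The Gaussian modulus in the equality case. -/

lemma gaussian_pos {E : ℝ} (hE : 0 < E) (l : ℝ) : 0 < gaussian E l := by
  have := Real.rpow_pos_of_pos hE (-(1 / 4))
  rw [gaussian]
  positivity

lemma gaussian_sq {E : ℝ} (hE : 0 < E) (l : ℝ) :
    gaussian E l ^ 2 =
      Real.sqrt (2 * Real.pi) * ProbabilityTheory.gaussianPDFReal 0 E.toNNReal l := by
  have h1 : (E ^ (-(1 / 4) : ℝ)) ^ 2 = (Real.sqrt E)⁻¹ := by
    rw [← Real.rpow_natCast, ← Real.rpow_mul hE.le, Real.sqrt_eq_rpow, ← Real.rpow_neg hE.le]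
    norm_num
  have h2 : Real.exp (-l ^ 2 / (4 * E)) ^ 2 = Real.exp (-l ^ 2 / (2 * E)) := by
    rw [← Real.exp_nat_mul]
    congr 1
    push_cast
    field_simp
    ring
  have h3 : Real.sqrt (2 * Real.pi) ≠ 0 := by positivity
  rw [gaussian, mul_pow, h1, h2, ProbabilityTheory.gaussianPDFReal]
  simp only [Real.coe_toNNReal E hE.le, sub_zero]
  rw [Real.sqrt_mul (by positivity) E, mul_inv, ← mul_assoc, ← mul_assoc, mul_inv_cancel₀ h3,
    one_mul]

/-- Since φ_E² is the ν-density of the normal law of variance E, the characteristic function, total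
mass and variance of that law can be used. -/
lemma gaussianReal_eq_nu {E : ℝ} (hE : 0 < E) :
    ProbabilityTheory.gaussianReal 0 E.toNNReal =
      nu.withDensity fun l => ENNReal.ofReal (gaussian E l ^ 2) := by
  have hv : E.toNNReal ≠ 0 := (Real.toNNReal_pos.2 hE).ne'
  rw [ProbabilityTheory.gaussianReal_of_var_ne_zero _ hv, nu, withDensity_smul_measure]
  have hm : Measurable fun l => ENNReal.ofReal (gaussian E l ^ 2) := by
    unfold gaussian
    fun_prop
  rw [← withDensity_smul _ hm]
  congr 1
  ext l
  rw [ProbabilityTheory.gaussianPDF, Pi.smul_apply, smul_eq_mul, gaussian_sq hE,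
    ← ENNReal.ofReal_mul (by positivity), ← mul_assoc, one_div, inv_mul_cancel₀ (by positivity),
    one_mul]

instance : SFinite nu := by
  unfold nu
  infer_instance

/-- Equality in the uncertainty relation forces a Gaussian modulus. -/
theorem norm_sq_eq_of_cost_le {E : ℝ} (hE : 0 < E) {M : POVM WaveSpace} (hM : M.IsCovariant)
    {x : WaveSpace} (h : cost E M x ≤ ENNReal.ofReal (‖x‖ ^ 2)) :
    ∀ᵐ l ∂nu, ‖x l‖ ^ 2 = ‖x‖ ^ 2 * gaussian E l ^ 2 := by
  have hmx : AEMeasurable (fun l => ENNReal.ofReal (‖x l‖ ^ 2)) nu :=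
    ((Lp.aestronglyMeasurable x).norm.pow 2).aemeasurable.ennreal_ofReal
  have hmg : Measurable fun l => ENNReal.ofReal (gaussian E l ^ 2) := by
    unfold gaussian
    fun_prop
  have hfin : ∫⁻ l, ENNReal.ofReal (‖x l‖ ^ 2) ∂nu ≠ ⊤ := by
    rw [← ofReal_norm_sq_eq_lintegral]
    exact ENNReal.ofReal_ne_top
  have : IsFiniteMeasure (nu.withDensity fun l => ENNReal.ofReal (‖x l‖ ^ 2)) :=
    isFiniteMeasure_withDensity hfin
  have : IsFiniteMeasure (ENNReal.ofReal (‖x‖ ^ 2) •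
      ProbabilityTheory.gaussianReal 0 E.toNNReal) :=
    Measure.smul_finite _ ENNReal.ofReal_ne_top
  -- ⟨x|f(s)x⟩ is the characteristic function of |x|²ν, and it has just been shown to be Gaussian.
  -- Finite measures with the same characteristic function agree, hence so do their densities almost
  -- everywhere.
  have key : (nu.withDensity fun l => ENNReal.ofReal (‖x l‖ ^ 2)) =
      ENNReal.ofReal (‖x‖ ^ 2) • ProbabilityTheory.gaussianReal 0 E.toNNReal := by
    apply Measure.ext_of_charFun
    ext s
    have h1 : charFun (nu.withDensity fun l => ENNReal.ofReal (‖x l‖ ^ 2)) s = ⟪x, rep s x⟫_ℂ := by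
      rw [charFun_apply_real, integral_withDensity_eq_integral_toReal_smul₀ hmx
        (Filter.Eventually.of_forall fun _ => ENNReal.ofReal_lt_top), inner_rep_right_eq_integral]
      refine integral_congr_ae (Filter.Eventually.of_forall fun l => ?_)
      simp only
      rw [ENNReal.toReal_ofReal (by positivity), Complex.mul_conj', Complex.real_smul, mul_comm]
      push_cast
      ring_nf
    have h2 : charFun (ENNReal.ofReal (‖x‖ ^ 2) •
        ProbabilityTheory.gaussianReal 0 E.toNNReal) s =
        ‖x‖ ^ 2 * charFun (ProbabilityTheory.gaussianReal 0 E.toNNReal) s := by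
      rw [charFun_apply_real, charFun_apply_real, integral_smul_measure,
        ENNReal.toReal_ofReal (by positivity), Complex.real_smul]
      push_cast
      rfl
    rw [h1, h2, inner_rep_of_cost_le hE hM h, ProbabilityTheory.charFun_gaussianReal]
    rw [Real.coe_toNNReal E hE.le]
    congr 2
    push_cast
    ring
  rw [gaussianReal_eq_nu hE, ← withDensity_smul _ hmg,
    withDensity_eq_iff hmx (hmg.const_smul _).aemeasurable hfin] at key
  filter_upwards [key] with l hl
  rw [Pi.smul_apply, smul_eq_mul, ← ENNReal.ofReal_mul (by positivity)] at hl
  exact (ENNReal.ofReal_eq_ofReal_iff (by positivity) (by positivity)).1 hl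


/-! ### The cost as a quadratic form and the line of equality cases. -/

lemma two_mul_ofReal (a : ℝ) : 2 * ENNReal.ofReal a = ENNReal.ofReal (2 * a) := by
  rw [ENNReal.ofReal_mul (by norm_num)]
  simp

lemma qSq_smul (c : ℂ) (x : WaveSpace) : qSq (c • x) = ENNReal.ofReal (‖c‖ ^ 2) * qSq x := by
  rw [qSq, qSq, ← lintegral_const_mul' _ _ ENNReal.ofReal_ne_top]
  refine lintegral_congr_ae ?_
  filter_upwards [Lp.coeFn_smul c x] with l h
  rw [h, Pi.smul_apply, norm_smul, ← ENNReal.ofReal_mul (by positivity)]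
  ring_nf

lemma POVM.dist_smul {H : Type*} [NormedAddCommGroup H] [InnerProductSpace ℂ H] [CompleteSpace H]
    (M : POVM H) (c : ℂ) (x : H) : M.dist (c • x) = ENNReal.ofReal (‖c‖ ^ 2) • M.dist x := by
  ext B hB
  rw [Measure.smul_apply, smul_eq_mul, dist_apply _ _ hB, dist_apply _ _ hB,
    ← ENNReal.ofReal_mul (by positivity), map_smul, inner_smul_left, inner_smul_right, ← mul_assoc,
    Complex.conj_mul', ← Complex.ofReal_pow, Complex.re_ofReal_mul]

lemma POVM.secondMoment_smul (M : POVM WaveSpace) (c : ℂ) (x : WaveSpace) :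
    M.secondMoment (c • x) = ENNReal.ofReal (‖c‖ ^ 2) * M.secondMoment x := by
  rw [secondMoment, dist_smul, lintegral_smul_measure]
  rfl

lemma cost_smul (E : ℝ) (M : POVM WaveSpace) (c : ℂ) (x : WaveSpace) :
    cost E M (c • x) = ENNReal.ofReal (‖c‖ ^ 2) * cost E M x := by
  rw [cost, cost, qSq_smul, M.secondMoment_smul]
  ring

lemma aemeasurable_qSq (x : WaveSpace) :
    AEMeasurable (fun l : ℝ => ENNReal.ofReal (l ^ 2 * ‖x l‖ ^ 2)) nu := by
  have h : AEMeasurable (fun l : ℝ => ‖x l‖ ^ 2) nu :=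
    ((Lp.aestronglyMeasurable x).norm.pow 2).aemeasurable
  have h2 : AEMeasurable (fun l : ℝ => l ^ 2) nu := by fun_prop
  exact (h2.mul h).ennreal_ofReal

lemma qSq_parallelogram (x y : WaveSpace) :
    qSq (x + y) + qSq (x - y) = 2 * (qSq x + qSq y) := by
  simp only [qSq]
  rw [← lintegral_add_left' (aemeasurable_qSq _), ← lintegral_add_left' (aemeasurable_qSq _),
    ← lintegral_const_mul' _ _ (by simp)]
  refine lintegral_congr_ae ?_
  filter_upwards [Lp.coeFn_add x y, Lp.coeFn_sub x y] with l h1 h2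
  have := parallelogram_law_with_norm ℂ (x l) (y l)
  rw [h1, h2, Pi.add_apply, Pi.sub_apply, ← ENNReal.ofReal_add (by positivity) (by positivity),
    ← ENNReal.ofReal_add (by positivity) (by positivity), two_mul_ofReal]
  congr 1
  linear_combination l ^ 2 * this

lemma POVM.dist_parallelogram {H : Type*} [NormedAddCommGroup H] [InnerProductSpace ℂ H]
    [CompleteSpace H] (M : POVM H) (x y : H) :
    M.dist (x + y) + M.dist (x - y) = (2 : ℝ≥0∞) • (M.dist x + M.dist y) := by
  ext B hB
  have hp : ∀ z, 0 ≤ (⟪z, M.eff B z⟫_ℂ).re := fun z =>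
    (M.isPositive _ hB).re_inner_nonneg_right z
  rw [Measure.smul_apply, smul_eq_mul, Measure.add_apply, Measure.add_apply, dist_apply _ _ hB,
    dist_apply _ _ hB, dist_apply _ _ hB, dist_apply _ _ hB, ← ENNReal.ofReal_add (hp _) (hp _),
    ← ENNReal.ofReal_add (hp _) (hp _), two_mul_ofReal]
  congr 1
  simp only [map_add, map_sub, inner_add_left, inner_add_right, inner_sub_left, inner_sub_right,
    Complex.add_re, Complex.sub_re]
  ring

lemma POVM.secondMoment_parallelogram (M : POVM WaveSpace) (x y : WaveSpace) :
    M.secondMoment (x + y) + M.secondMoment (x - y) =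
      2 * (M.secondMoment x + M.secondMoment y) := by
  simp only [secondMoment]
  rw [← lintegral_add_measure, ← lintegral_add_measure, dist_parallelogram,
    lintegral_smul_measure]
  rfl

lemma cost_parallelogram (E : ℝ) (M : POVM WaveSpace) (x y : WaveSpace) :
    cost E M (x + y) + cost E M (x - y) = 2 * (cost E M x + cost E M y) := by
  have h1 := qSq_parallelogram x y
  have h2 := M.secondMoment_parallelogram x y
  simp only [cost]
  calc _ = ENNReal.ofReal (1 / (2 * E)) * (qSq (x + y) + qSq (x - y)) +
        ENNReal.ofReal (2 * E) * (M.secondMoment (x + y) + M.secondMoment (x - y)) := by ring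
    _ = _ := by rw [h1, h2]; ring

/-- The excess of the cost over ‖·‖² is nonnegative and obeys the parallelogram law, so its zeros
are closed under addition. In [0, ∞] the excess is not subtracted; instead the finite term ‖x − y‖²
is cancelled. -/
lemma cost_add_le {E : ℝ} (hE : 0 < E) {M : POVM WaveSpace} (hM : M.IsCovariant)
    {x y : WaveSpace} (hx : cost E M x ≤ ENNReal.ofReal (‖x‖ ^ 2))
    (hy : cost E M y ≤ ENNReal.ofReal (‖y‖ ^ 2)) :
    cost E M (x + y) ≤ ENNReal.ofReal (‖x + y‖ ^ 2) := by
  have h1 := norm_sq_le_cost hE hM (x - y)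
  have h2 : ENNReal.ofReal (‖x + y‖ ^ 2) + ENNReal.ofReal (‖x - y‖ ^ 2) =
      2 * (ENNReal.ofReal (‖x‖ ^ 2) + ENNReal.ofReal (‖y‖ ^ 2)) := by
    rw [← ENNReal.ofReal_add (by positivity) (by positivity),
      ← ENNReal.ofReal_add (by positivity) (by positivity),
      two_mul_ofReal]
    congr 1
    have := parallelogram_law_with_norm ℂ x y
    linarith
  refine (ENNReal.add_le_add_iff_right (a := ENNReal.ofReal (‖x - y‖ ^ 2))
    ENNReal.ofReal_ne_top).1 ?_
  calc _ ≤ cost E M (x + y) + cost E M (x - y) := by gcongr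
    _ = 2 * (cost E M x + cost E M y) := cost_parallelogram E M x y
    _ ≤ 2 * (ENNReal.ofReal (‖x‖ ^ 2) + ENNReal.ofReal (‖y‖ ^ 2)) := by gcongr
    _ = _ := h2.symm

lemma cost_smul_le {E : ℝ} {M : POVM WaveSpace} {x : WaveSpace}
    (hx : cost E M x ≤ ENNReal.ofReal (‖x‖ ^ 2)) (c : ℂ) :
    cost E M (c • x) ≤ ENNReal.ofReal (‖c • x‖ ^ 2) := by
  rw [cost_smul, norm_smul, mul_pow, ENNReal.ofReal_mul (by positivity)]
  gcongr

/-- The equality cases of the uncertainty relation for a given measurement form a line. -/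
theorem exists_eq_smul_of_cost_le {E : ℝ} (hE : 0 < E) {M : POVM WaveSpace} (hM : M.IsCovariant)
    {x y : WaveSpace} (hx : cost E M x ≤ ENNReal.ofReal (‖x‖ ^ 2))
    (hy : cost E M y ≤ ENNReal.ofReal (‖y‖ ^ 2)) (hy0 : y ≠ 0) : ∃ c : ℂ, x = c • y := by
  have hb : ‖y‖ ^ 2 ≠ 0 := by simpa using hy0
  have hI := cost_smul_le hy Complex.I
  -- By polarisation z = ⟨y|x⟩. The vectors x, y, x + y and x + iy are all equality cases, so their
  -- squared moduli are multiples of the same positive G. Pointwise polarisation then gives x ȳ = z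
  -- G, while y ȳ = ‖y‖² G, and the quotient x/y is constant.
  set z : ℂ := ⟨(‖x + y‖ ^ 2 - ‖x‖ ^ 2 - ‖y‖ ^ 2) / 2,
    (‖x + Complex.I • y‖ ^ 2 - ‖x‖ ^ 2 - ‖y‖ ^ 2) / 2⟩ with hz
  refine ⟨z / (‖y‖ ^ 2 : ℝ), Lp.ext ?_⟩
  filter_upwards [norm_sq_eq_of_cost_le hE hM hx, norm_sq_eq_of_cost_le hE hM hy,
    norm_sq_eq_of_cost_le hE hM (cost_add_le hE hM hx hy),
    norm_sq_eq_of_cost_le hE hM (cost_add_le hE hM hx hI), Lp.coeFn_add x y,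
    Lp.coeFn_add x (Complex.I • y), Lp.coeFn_smul Complex.I y,
    Lp.coeFn_smul (z / (‖y‖ ^ 2 : ℝ)) y] with l h1 h2 h3 h4 e1 e2 e3 e4
  rw [e1, Pi.add_apply] at h3
  rw [e2, Pi.add_apply, e3, Pi.smul_apply, smul_eq_mul] at h4
  rw [e4, Pi.smul_apply, smul_eq_mul]
  have hG := (pow_pos (gaussian_pos hE l) 2).ne'
  set G := gaussian E l ^ 2
  have k1 : x l * (starRingEnd ℂ) (y l) = z * G := by
    simp only [← Complex.normSq_eq_norm_sq] at h1 h2 h3 h4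
    rw [Complex.normSq_apply] at h1 h2 h3 h4
    simp only [Complex.add_re, Complex.add_im, Complex.I_mul_re, Complex.I_mul_im] at h3 h4
    have zr : z.re = (‖x + y‖ ^ 2 - ‖x‖ ^ 2 - ‖y‖ ^ 2) / 2 := rfl
    have zi : z.im = (‖x + Complex.I • y‖ ^ 2 - ‖x‖ ^ 2 - ‖y‖ ^ 2) / 2 := rfl
    apply Complex.ext <;>
      simp only [zr, zi, Complex.mul_re, Complex.mul_im, Complex.conj_re, Complex.conj_im,
        Complex.ofReal_re, Complex.ofReal_im]
    · linear_combination (h3 - h1 - h2) / 2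
    · linear_combination (h4 - h1 - h2) / 2
  have k2 : y l * (starRingEnd ℂ) (y l) = (‖y‖ ^ 2 : ℝ) * G := by
    rw [Complex.mul_conj', ← Complex.ofReal_pow, h2]
    push_cast
    ring
  have hG' : (G : ℂ) ≠ 0 := by exact_mod_cast hG
  have hb' : ((‖y‖ ^ 2 : ℝ) : ℂ) ≠ 0 := by exact_mod_cast hb
  rw [div_mul_eq_mul_div, eq_div_iff hb']
  apply mul_right_cancel₀ hG'
  linear_combination (-x l) * k2 + y l * k1

/-! ### Mixed states -/

section Density

variable {H : Type*} [NormedAddCommGroup H] [InnerProductSpace ℂ H] [CompleteSpace H]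

/-- The images of the fixed basis vectors under the root of a density operator. -/
noncomputable def DensityOp.vec (ρ : DensityOp H) (i : basisSet H) : H :=
  CFC.sqrt ρ.op (basis H i)

lemma tsum_norm_vec_eq_one (ρ : DensityOp H) :
    ∑' i, ENNReal.ofReal (‖ρ.vec i‖ ^ 2) = 1 := by
  simp only [DensityOp.vec]
  rw [← traceIn_eq _ ρ.isPositive]
  exact ρ.trace_eq_one

/-- A density operator whose root maps a basis into the line of a unit vector is pure. -/
lemma op_eq_rankOne (ρ : DensityOp H) {φ : H} (hφ : ‖φ‖ = 1)
    (h : ∀ i, ∃ c : ℂ, ρ.vec i = c • φ) :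
    ρ.op = InnerProductSpace.rankOne ℂ φ φ := by
  choose c hc using h
  have h1 := tsum_norm_vec_eq_one ρ
  simp only [hc, norm_smul, hφ, mul_one] at h1
  have h0 : 0 ≤ ρ.op := (ContinuousLinearMap.nonneg_iff_isPositive _).2 ρ.isPositive
  refine ContinuousLinearMap.coe_injective ((ext_inner_map _ _).1 fun x => ?_)
  -- By Parseval the left side is ∑|⟨√ρ eⱼ|x⟩|² = ∑|cⱼ|² |⟨φ|x⟩|², and ∑|cⱼ|² = 1 is the trace
  -- condition. The quadratic form then determines the operator.
  have h2 : ENNReal.ofReal (‖CFC.sqrt ρ.op x‖ ^ 2) = ENNReal.ofReal (‖⟪φ, x⟫_ℂ‖ ^ 2) := by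
    rw [parseval (basis H)]
    have e : ∀ j, ENNReal.ofReal (‖⟪basis H j, CFC.sqrt ρ.op x⟫_ℂ‖ ^ 2) =
        ENNReal.ofReal (‖c j‖ ^ 2) * ENNReal.ofReal (‖⟪φ, x⟫_ℂ‖ ^ 2) := by
      intro j
      rw [sqrt_inner_comm, ← DensityOp.vec, hc, inner_smul_left, norm_mul, mul_pow, RCLike.norm_conj,
        ENNReal.ofReal_mul (by positivity)]
    simp only [e]
    rw [ENNReal.tsum_mul_right, h1, one_mul]
  have h3 := (ENNReal.ofReal_eq_ofReal_iff (by positivity) (by positivity)).1 h2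
  have h4 : ρ.op x = CFC.sqrt ρ.op (CFC.sqrt ρ.op x) := by
    conv_lhs => rw [← CFC.sqrt_mul_sqrt_self ρ.op h0]
    rfl
  simp only [ContinuousLinearMap.coe_coe, InnerProductSpace.rankOne_apply]
  rw [h4, ← sqrt_inner_comm, inner_self_eq_norm_sq_to_K, inner_smul_left, Complex.conj_mul']
  have h5 := congrArg (fun r : ℝ => (r : ℂ)) h3
  push_cast at h5
  exact h5

lemma sqrt_rankOne {φ : H} (hφ : ‖φ‖ = 1) :
    CFC.sqrt (InnerProductSpace.rankOne ℂ φ φ) = InnerProductSpace.rankOne ℂ φ φ := by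
  refine CFC.sqrt_unique (InnerProductSpace.isIdempotentElem_rankOne_self hφ) ?_
  rw [ContinuousLinearMap.nonneg_iff_isPositive]
  exact InnerProductSpace.isPositive_rankOne_self φ

lemma tsum_norm_inner_basis {φ : H} (hφ : ‖φ‖ = 1) :
    ∑' i, ENNReal.ofReal (‖⟪φ, basis H i⟫_ℂ‖ ^ 2) = 1 := by
  simp_rw [norm_inner_symm φ]
  rw [← parseval, hφ]
  simp

/-- The pure state of a unit vector. -/
noncomputable def pureState (φ : H) (hφ : ‖φ‖ = 1) : DensityOp H where
  op := InnerProductSpace.rankOne ℂ φ φ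
  isPositive := InnerProductSpace.isPositive_rankOne_self φ
  trace_eq_one := by
    rw [trace, traceIn_eq _ (InnerProductSpace.isPositive_rankOne_self φ), sqrt_rankOne hφ]
    simp only [InnerProductSpace.rankOne_apply, norm_smul, hφ, mul_one]
    exact tsum_norm_inner_basis hφ

lemma POVM.outcome_rankOne (M : POVM H) {φ : H} (hφ : ‖φ‖ = 1) :
    M.outcome (InnerProductSpace.rankOne ℂ φ φ) = M.dist φ := by
  rw [outcome_eq_sum, sqrt_rankOne hφ]
  ext B hB
  simp only [InnerProductSpace.rankOne_apply, dist_smul]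
  rw [Measure.sum_apply _ hB]
  simp only [Measure.smul_apply, smul_eq_mul]
  rw [ENNReal.tsum_mul_right, tsum_norm_inner_basis hφ, one_mul]

end Density

lemma energy_of_op_eq {ρ : DensityOp WaveSpace} {φ : WaveSpace} (hφ : ‖φ‖ = 1)
    (h : ρ.op = InnerProductSpace.rankOne ℂ φ φ) : energy ρ = qSq φ := by
  rw [energy, traceForm, h, sqrt_rankOne hφ]
  simp only [InnerProductSpace.rankOne_apply, qSq_smul]
  rw [ENNReal.tsum_mul_right, tsum_norm_inner_basis hφ, one_mul]

/-- Covariance makes the error independent of the true value, so the supremum is that of a constant.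
-/
lemma worstError_of_op_eq {ρ : DensityOp WaveSpace} {φ : WaveSpace} (hφ : ‖φ‖ = 1)
    (h : ρ.op = InnerProductSpace.rankOne ℂ φ φ) {M : POVM WaveSpace} (hM : M.IsCovariant) :
    worstError ρ M = M.secondMoment φ := by
  have e : ∀ g, errorAt g ρ M = M.secondMoment φ := by
    intro g
    have h1 : rep g ∘L ρ.op ∘L ContinuousLinearMap.adjoint (rep g) =
        InnerProductSpace.rankOne ℂ (rep g φ) (rep g φ) := by
      ext1 x
      simp only [h, ContinuousLinearMap.comp_apply, InnerProductSpace.rankOne_apply, map_smul,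
        adjoint_rep, inner_rep_left]
    rw [errorAt, h1, M.outcome_rankOne (by rw [norm_rep, hφ]), hM.dist_rep,
      lintegral_map (by fun_prop) (by fun_prop)]
    simp [POVM.secondMoment]
  simp [worstError, e]

lemma errorAt_zero (ρ : DensityOp WaveSpace) (M : POVM WaveSpace) :
    errorAt 0 ρ M = ∑' i, M.secondMoment (ρ.vec i) := by
  have h1 : rep 0 ∘L ρ.op ∘L ContinuousLinearMap.adjoint (rep 0) = ρ.op := by
    ext1 x
    simp only [ContinuousLinearMap.comp_apply, adjoint_rep, neg_zero, rep_zero]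
  rw [errorAt, h1, M.outcome_eq_sum, lintegral_sum_measure]
  simp only [sub_zero]
  rfl

/-- The cost of a mixed state. -/
noncomputable def mixedCost (E : ℝ) (M : POVM WaveSpace) (ρ : DensityOp WaveSpace) : ℝ≥0∞ :=
  ENNReal.ofReal (1 / (2 * E)) * energy ρ + ENNReal.ofReal (2 * E) * worstError ρ M

/-- For the lower bound the error at the true value 0 is enough; there energy and error are both
sums over the vectors √ρ eᵢ. -/
lemma tsum_cost_le (E : ℝ) (M : POVM WaveSpace) (ρ : DensityOp WaveSpace) :
    ∑' i, cost E M (ρ.vec i) ≤ mixedCost E M ρ := by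
  simp only [cost]
  rw [ENNReal.tsum_add, ENNReal.tsum_mul_left, ENNReal.tsum_mul_left, ← errorAt_zero, mixedCost]
  gcongr
  · exact le_rfl
  · exact le_iSup (fun g => errorAt g ρ M) 0

lemma one_le_mixedCost {E : ℝ} (hE : 0 < E) {M : POVM WaveSpace} (hM : M.IsCovariant)
    (ρ : DensityOp WaveSpace) : 1 ≤ mixedCost E M ρ := by
  rw [← tsum_norm_vec_eq_one ρ]
  exact (ENNReal.tsum_le_tsum fun i => norm_sq_le_cost hE hM _).trans (tsum_cost_le E M ρ)

/-- A state of minimal cost is pure, and its wave function is an equality case of the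
uncertainty relation. -/
theorem exists_pure_of_mixedCost_le {E : ℝ} (hE : 0 < E) {M : POVM WaveSpace} (hM : M.IsCovariant)
    {ρ : DensityOp WaveSpace} (h : mixedCost E M ρ ≤ 1) :
    ∃ φ : WaveSpace, ‖φ‖ = 1 ∧ cost E M φ ≤ ENNReal.ofReal (‖φ‖ ^ 2) ∧
      ρ.op = InnerProductSpace.rankOne ℂ φ φ := by
  have h1 := tsum_norm_vec_eq_one ρ
  have h2 := (tsum_cost_le E M ρ).trans h
  -- Each cost dominates the matching squared norm and these norms add up to 1, so a strict
  -- inequality at one index would push the sum above 1.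
  have h3 : ∀ i, cost E M (ρ.vec i) ≤
      ENNReal.ofReal (‖ρ.vec i‖ ^ 2) := by
    intro i
    by_contra hi
    rw [not_le] at hi
    have := ENNReal.tsum_lt_tsum (by rw [h1]; simp) (fun j => norm_sq_le_cost hE hM _) hi
    rw [h1] at this
    exact absurd h2 (not_le.2 this)
  obtain ⟨k, hk⟩ : ∃ k, ρ.vec k ≠ 0 := by
    by_contra! h0
    simp [h0] at h1
  set v := ρ.vec k
  have hv : ‖v‖ ≠ 0 := by simpa using hk
  have hφ : ‖((‖v‖⁻¹ : ℝ) : ℂ) • v‖ = 1 := by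
    rw [norm_smul, Complex.norm_real, norm_inv, norm_norm, inv_mul_cancel₀ hv]
  have hφ0 : ((‖v‖⁻¹ : ℝ) : ℂ) • v ≠ 0 := by
    intro h0
    rw [h0, norm_zero] at hφ
    exact zero_ne_one hφ
  have hc := cost_smul_le (h3 k) ((‖v‖⁻¹ : ℝ) : ℂ)
  exact ⟨_, hφ, hc, op_eq_rankOne ρ hφ fun i => exists_eq_smul_of_cost_le hE hM (h3 i) hc hφ0⟩


/-! ### Multiplication operators and measurements given by an isometry -/

/-- Multiplication by an essentially bounded function. -/
noncomputable def mulOp (u : ℝ → ℂ) (hu : MemLp u ⊤ nu) : WaveSpace →L[ℂ] WaveSpace :=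
  (ContinuousLinearMap.lsmul ℂ ℂ).holderL nu ⊤ 2 2 (hu.toLp u)

lemma mulOp_coeFn (u : ℝ → ℂ) (hu : MemLp u ⊤ nu) (x : WaveSpace) :
    mulOp u hu x =ᵐ[nu] fun l => u l * x l := by
  filter_upwards [(ContinuousLinearMap.lsmul ℂ ℂ).coeFn_holder (r := 2) (hu.toLp u) x,
    hu.coeFn_toLp] with l h1 h2
  rw [mulOp, ContinuousLinearMap.holderL_apply_apply, h1, h2]
  rfl

lemma memLp_indicator_one {B : Set ℝ} (hB : MeasurableSet B) :
    MemLp (B.indicator fun _ => (1 : ℂ)) ⊤ nu := by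
  refine memLp_top_of_bound ((measurable_const.indicator hB).aestronglyMeasurable) 1
    (Filter.Eventually.of_forall fun l => ?_)
  refine (norm_indicator_le_norm_self _ _).trans ?_
  simp

open Classical in
/-- Multiplication by the indicator function of a measurable set. -/
noncomputable def indicatorOp (B : Set ℝ) : WaveSpace →L[ℂ] WaveSpace :=
  if hB : MeasurableSet B then mulOp _ (memLp_indicator_one hB) else 0

lemma indicatorOp_coeFn {B : Set ℝ} (hB : MeasurableSet B) (x : WaveSpace) :
    indicatorOp B x =ᵐ[nu] B.indicator x := by
  rw [indicatorOp, dif_pos hB]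
  filter_upwards [mulOp_coeFn _ (memLp_indicator_one hB) x] with l h
  rw [h]
  by_cases hl : l ∈ B <;> simp [hl]

lemma inner_indicatorOp {B : Set ℝ} (hB : MeasurableSet B) (x : WaveSpace) :
    ⟪x, indicatorOp B x⟫_ℂ = ((∫ l in B, ‖x l‖ ^ 2 ∂nu : ℝ) : ℂ) := by
  rw [WaveSpace.inner_eq, ← integral_indicator hB, ← integral_complex_ofReal]
  refine integral_congr_ae ?_
  filter_upwards [indicatorOp_coeFn hB x] with l h
  rw [h]
  by_cases hl : l ∈ B
  · simp [hl, Complex.mul_conj']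
  · simp [hl]

lemma indicatorOp_comm {B : Set ℝ} (hB : MeasurableSet B) (x y : WaveSpace) :
    ⟪indicatorOp B x, y⟫_ℂ = ⟪x, indicatorOp B y⟫_ℂ := by
  rw [WaveSpace.inner_eq, WaveSpace.inner_eq]
  refine integral_congr_ae ?_
  filter_upwards [indicatorOp_coeFn hB x, indicatorOp_coeFn hB y] with l h1 h2
  rw [h1, h2]
  by_cases hl : l ∈ B <;> simp [hl]

lemma WaveSpace.integrable_norm_sq (x : WaveSpace) : Integrable (fun l => ‖x l‖ ^ 2) nu :=
  (memLp_two_iff_integrable_sq_norm (Lp.aestronglyMeasurable x)).1 (Lp.memLp x)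

lemma inner_adjoint_indicatorOp (T : WaveSpace →ₗᵢ[ℂ] WaveSpace) {B : Set ℝ}
    (hB : MeasurableSet B) (x : WaveSpace) :
    ⟪x, (ContinuousLinearMap.adjoint T.toContinuousLinearMap ∘L indicatorOp B ∘L
      T.toContinuousLinearMap) x⟫_ℂ = ((∫ l in B, ‖T x l‖ ^ 2 ∂nu : ℝ) : ℂ) := by
  rw [ContinuousLinearMap.comp_apply, ContinuousLinearMap.adjoint_inner_right]
  exact inner_indicatorOp hB (T x)

/-- The measurement with the outcome density `|T x|²`, for an isometry `T`. -/
noncomputable def isoPOVM (T : WaveSpace →ₗᵢ[ℂ] WaveSpace) : POVM WaveSpace where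
  eff B := ContinuousLinearMap.adjoint T.toContinuousLinearMap ∘L indicatorOp B ∘L
    T.toContinuousLinearMap
  isPositive B hB := by
    refine ContinuousLinearMap.IsPositive.adjoint_conj ⟨indicatorOp_comm hB, fun x => ?_⟩ _
    rw [ContinuousLinearMap.reApplyInnerSelf_apply, indicatorOp_comm hB, inner_indicatorOp hB]
    exact integral_nonneg fun _ => by positivity
  eff_univ := by
    ext1 x
    refine ext_inner_left ℂ fun v => ?_
    have h : indicatorOp Set.univ (T x) = T x := by
      apply Lp.ext
      filter_upwards [indicatorOp_coeFn MeasurableSet.univ (T x)] with l hl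
      rw [hl, Set.indicator_univ]
    rw [ContinuousLinearMap.comp_apply, ContinuousLinearMap.adjoint_inner_right]
    exact (congrArg _ h).trans (T.inner_map_map v x)
  hasSum_eff B hB hd x := by
    simp only [inner_adjoint_indicatorOp T (hB _), inner_adjoint_indicatorOp T (MeasurableSet.iUnion hB)]
    exact Complex.hasSum_ofReal.2 (hasSum_integral_iUnion hB hd (T x).integrable_norm_sq.integrableOn)

lemma isoPOVM_inner (T : WaveSpace →ₗᵢ[ℂ] WaveSpace) {B : Set ℝ} (hB : MeasurableSet B)
    (x : WaveSpace) :
    ⟪x, (isoPOVM T).eff B x⟫_ℂ = ((∫ l in B, ‖T x l‖ ^ 2 ∂nu : ℝ) : ℂ) :=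
  inner_adjoint_indicatorOp T hB x

lemma isoPOVM_secondMoment (T : WaveSpace →ₗᵢ[ℂ] WaveSpace) (x : WaveSpace) :
    (isoPOVM T).secondMoment x = qSq (T x) := by
  have hm : AEMeasurable (fun l => ENNReal.ofReal (‖T x l‖ ^ 2)) nu :=
    ((Lp.aestronglyMeasurable (T x)).norm.pow 2).aemeasurable.ennreal_ofReal
  have h : (isoPOVM T).dist x = nu.withDensity fun l => ENNReal.ofReal (‖T x l‖ ^ 2) := by
    ext B hB
    rw [POVM.dist_apply _ _ hB, isoPOVM_inner T hB, Complex.ofReal_re, withDensity_apply _ hB,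
      ofReal_integral_eq_lintegral_ofReal (T x).integrable_norm_sq.integrableOn
        (Filter.Eventually.of_forall fun _ => by positivity)]
  rw [POVM.secondMoment, h, lintegral_withDensity_eq_lintegral_mul₀ hm (by fun_prop), qSq]
  refine lintegral_congr fun l => ?_
  rw [Pi.mul_apply, ← ENNReal.ofReal_mul (by positivity), mul_comm]

lemma nu_add_right (s : ℝ) : MeasurePreserving (fun x : ℝ => x + s) nu nu := by
  refine ⟨by fun_prop, ?_⟩
  rw [nu, Measure.map_smul, (measurePreserving_add_right volume s).map_eq]

/-- Quadratic forms determine the effects, so intertwining with translations reduces covariance to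
the translation invariance of ν. -/
lemma isoPOVM_isCovariant {T : WaveSpace →ₗᵢ[ℂ] WaveSpace}
    (hT : ∀ (s : ℝ) (x : WaveSpace), ∀ᵐ l ∂nu, T (rep s x) l = T x (l - s)) :
    (isoPOVM T).IsCovariant := by
  intro g B hB
  have hB' : MeasurableSet ((fun x => g + x) '' B) :=
    (MeasurableEquiv.addLeft g).measurableSet_image.2 hB
  refine ContinuousLinearMap.coe_injective ((ext_inner_map _ _).1 fun x => ?_)
  rw [← inner_conj_symm, ← inner_conj_symm _ x]
  congr 1
  have h1 : ⟪x, (rep g ∘L (isoPOVM T).eff B ∘L ContinuousLinearMap.adjoint (rep g)) x⟫_ℂ =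
      ⟪rep (-g) x, (isoPOVM T).eff B (rep (-g) x)⟫_ℂ := by
    rw [inner_rep_left, neg_neg, adjoint_rep]
    rfl
  refine h1.trans ?_
  refine Eq.trans ?_ (isoPOVM_inner T hB' x).symm
  rw [isoPOVM_inner T hB]
  congr 1
  have e2 : B = (fun x => x + g) ⁻¹' ((fun x => g + x) '' B) := by
    ext y
    simp [add_comm]
  have h2 := (nu_add_right g).setIntegral_preimage_emb (Homeomorph.addRight g).measurableEmbedding
    (fun l => ‖T x l‖ ^ 2) ((fun x => g + x) '' B)
  rw [← e2] at h2
  rw [← h2]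
  refine integral_congr_ae (ae_restrict_of_ae ?_)
  filter_upwards [hT (-g) x] with l h
  rw [h, sub_neg_eq_add]


/-! ### The Fourier transform on `L²` -/

lemma ae_nu_iff {p : ℝ → Prop} : (∀ᵐ l ∂nu, p l) ↔ ∀ᵐ l : ℝ, p l := by
  have h : ENNReal.ofReal (1 / Real.sqrt (2 * Real.pi)) ≠ 0 := by
    rw [ne_eq, ENNReal.ofReal_eq_zero, not_le]
    positivity
  exact Measure.ae_ennreal_smul_measure_iff h

/-- A wave function as an element of `L²` of the Lebesgue measure. -/
noncomputable def lebesgueL2 (φ : WaveSpace) : Lp ℂ 2 (volume : Measure ℝ) :=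
  (memLp_volume φ).toLp φ

lemma lebesgueL2_coeFn (φ : WaveSpace) : lebesgueL2 φ =ᵐ[volume] φ := MemLp.coeFn_toLp _

lemma lebesgueL2_add (φ ψ : WaveSpace) : lebesgueL2 (φ + ψ) = lebesgueL2 φ + lebesgueL2 ψ := by
  apply Lp.ext
  filter_upwards [lebesgueL2_coeFn (φ + ψ), lebesgueL2_coeFn φ, lebesgueL2_coeFn ψ,
    Lp.coeFn_add (lebesgueL2 φ) (lebesgueL2 ψ), ae_nu_iff.1 (Lp.coeFn_add φ ψ)] with l h1 h2 h3 h4 h5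
  rw [h1, h4, h5, Pi.add_apply, Pi.add_apply, h2, h3]

lemma lebesgueL2_smul (c : ℂ) (φ : WaveSpace) : lebesgueL2 (c • φ) = c • lebesgueL2 φ := by
  apply Lp.ext
  filter_upwards [lebesgueL2_coeFn (c • φ), lebesgueL2_coeFn φ,
    Lp.coeFn_smul c (lebesgueL2 φ), ae_nu_iff.1 (Lp.coeFn_smul c φ)] with l h1 h2 h4 h5
  rw [h1, h4, h5, Pi.smul_apply, Pi.smul_apply, h2]

/-- The Fourier transform in Mathlib's normalisation. -/
noncomputable def hat (φ : WaveSpace) : Lp ℂ 2 (volume : Measure ℝ) := 𝓕 (lebesgueL2 φ)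

lemma invFourier_eq (φ : WaveSpace) (g : ℝ) : invFourier φ g =
    (1 / Real.sqrt (2 * Real.pi) : ℝ) * hat φ (g / (2 * Real.pi)) := rfl

lemma hat_add (φ ψ : WaveSpace) : hat (φ + ψ) = hat φ + hat ψ := by
  rw [hat, lebesgueL2_add, FourierTransform.fourier_add]
  rfl

lemma hat_smul (c : ℂ) (φ : WaveSpace) : hat (c • φ) = c • hat φ := by
  rw [hat, lebesgueL2_smul, FourierTransform.fourier_smul]
  rfl

lemma norm_hat (φ : WaveSpace) : ‖hat φ‖ = ‖lebesgueL2 φ‖ := Lp.norm_fourier_eq _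

lemma lintegral_nu (f : ℝ → ℝ≥0∞) : ∫⁻ l, f l ∂nu =
    ENNReal.ofReal (1 / Real.sqrt (2 * Real.pi)) * ∫⁻ l, f l := by
  rw [nu, lintegral_smul_measure]
  rfl

lemma ofReal_norm_lebesgueL2 (φ : WaveSpace) :
    ENNReal.ofReal (‖φ‖ ^ 2) =
      ENNReal.ofReal (1 / Real.sqrt (2 * Real.pi)) * ENNReal.ofReal (‖lebesgueL2 φ‖ ^ 2) := by
  rw [ofReal_norm_sq_eq_lintegral, ofReal_norm_sq_eq_lintegral, lintegral_nu]
  congr 1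
  refine lintegral_congr_ae ?_
  filter_upwards [lebesgueL2_coeFn φ] with l h
  rw [h]

/-- The change of variable between the two Fourier normalisations. The factor √(2π) times the
squared prefactor 1/(2π) is the density 1/√(2π) of ν, so `invFourier` preserves the norm. -/
lemma nu_map_div : Measure.map (fun g : ℝ => g / (2 * Real.pi)) nu =
    ENNReal.ofReal (Real.sqrt (2 * Real.pi)) • (volume : Measure ℝ) := by
  have h : (fun g : ℝ => g / (2 * Real.pi)) = fun g => (2 * Real.pi)⁻¹ * g := by
    ext g
    ring
  have hs : Real.sqrt (2 * Real.pi) * Real.sqrt (2 * Real.pi) = 2 * Real.pi :=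
    Real.mul_self_sqrt (by positivity)
  rw [h, nu, Measure.map_smul, Real.map_volume_mul_left (by positivity), smul_smul,
    ← ENNReal.ofReal_mul (by positivity), inv_inv, abs_of_pos (by positivity)]
  congr 2
  rw [one_div, inv_mul_eq_div, div_eq_iff (by positivity), hs]

lemma ae_nu_div {p : ℝ → Prop} (h : ∀ᵐ w : ℝ, p w) : ∀ᵐ g ∂nu, p (g / (2 * Real.pi)) := by
  refine ae_of_ae_map (f := fun g : ℝ => g / (2 * Real.pi)) (by fun_prop) ?_
  rw [nu_map_div]
  exact Measure.ae_smul_measure h _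

lemma memLp_invFourier (φ : WaveSpace) : MemLp (invFourier φ) 2 nu := by
  have h1 : MemLp (hat φ) 2 (Measure.map (fun g : ℝ => g / (2 * Real.pi)) nu) := by
    rw [nu_map_div]
    exact (Lp.memLp _).smul_measure ENNReal.ofReal_ne_top
  have h2 : MemLp (fun g : ℝ => hat φ (g / (2 * Real.pi))) 2 nu :=
    (memLp_map_measure_iff h1.1 (by fun_prop)).1 h1
  exact h2.const_mul _

lemma lintegral_norm_invFourier_sq (φ : WaveSpace) :
    ∫⁻ g, ENNReal.ofReal (‖invFourier φ g‖ ^ 2) ∂nu = ENNReal.ofReal (‖φ‖ ^ 2) := by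
  have hc : (0 : ℝ) < 1 / Real.sqrt (2 * Real.pi) := by positivity
  have hm : AEMeasurable (fun w => ENNReal.ofReal (‖hat φ w‖ ^ 2))
      (Measure.map (fun g : ℝ => g / (2 * Real.pi)) nu) := by
    rw [nu_map_div]
    exact (((Lp.aestronglyMeasurable (hat φ)).norm.pow 2).aemeasurable.ennreal_ofReal).smul_measure _
  have h1 : ∀ g, ENNReal.ofReal (‖invFourier φ g‖ ^ 2) =
      ENNReal.ofReal ((1 / Real.sqrt (2 * Real.pi)) ^ 2) *
        ENNReal.ofReal (‖hat φ (g / (2 * Real.pi))‖ ^ 2) := by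
    intro g
    rw [invFourier_eq, norm_mul, mul_pow, Complex.norm_real, Real.norm_of_nonneg hc.le,
      ENNReal.ofReal_mul (by positivity)]
  simp only [h1]
  rw [lintegral_const_mul' _ _ ENNReal.ofReal_ne_top, ← lintegral_map' hm (by fun_prop),
    nu_map_div, lintegral_smul_measure, ← ofReal_norm_sq_eq_lintegral, norm_hat,
    ofReal_norm_lebesgueL2, smul_eq_mul, ← mul_assoc, ← ENNReal.ofReal_mul (by positivity)]
  congr 2
  field_simp

/-- The inverse Fourier transform as an isometry. -/
noncomputable def fourierIso : WaveSpace →ₗᵢ[ℂ] WaveSpace where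
  toFun φ := (memLp_invFourier φ).toLp _
  map_add' φ ψ := by
    apply Lp.ext
    filter_upwards [(memLp_invFourier (φ + ψ)).coeFn_toLp, (memLp_invFourier φ).coeFn_toLp,
      (memLp_invFourier ψ).coeFn_toLp, Lp.coeFn_add ((memLp_invFourier φ).toLp _)
        ((memLp_invFourier ψ).toLp _), ae_nu_div (Lp.coeFn_add (hat φ) (hat ψ))]
      with l h1 h2 h3 h4 h5
    rw [h1, h4, Pi.add_apply, h2, h3, invFourier_eq, invFourier_eq, invFourier_eq, hat_add, h5,
      Pi.add_apply, mul_add]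
  map_smul' c φ := by
    apply Lp.ext
    filter_upwards [(memLp_invFourier (c • φ)).coeFn_toLp, (memLp_invFourier φ).coeFn_toLp,
      Lp.coeFn_smul c ((memLp_invFourier φ).toLp _), ae_nu_div (Lp.coeFn_smul c (hat φ))]
      with l h1 h2 h4 h5
    rw [RingHom.id_apply, h1, h4, Pi.smul_apply, h2, invFourier_eq, invFourier_eq, hat_smul, h5,
      Pi.smul_apply, smul_eq_mul, smul_eq_mul]
    ring
  norm_map' φ := by
    have h : ENNReal.ofReal (‖(memLp_invFourier φ).toLp (invFourier φ)‖ ^ 2) =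
        ENNReal.ofReal (‖φ‖ ^ 2) := by
      rw [ofReal_norm_sq_eq_lintegral, ← lintegral_norm_invFourier_sq]
      refine lintegral_congr_ae ?_
      filter_upwards [(memLp_invFourier φ).coeFn_toLp] with l h1
      rw [h1]
    have h2 := (ENNReal.ofReal_eq_ofReal_iff (by positivity) (by positivity)).1 h
    exact (pow_left_inj₀ (norm_nonneg _) (norm_nonneg _) two_ne_zero).1 h2

lemma fourierIso_coeFn (φ : WaveSpace) : fourierIso φ =ᵐ[nu] invFourier φ :=
  (memLp_invFourier φ).coeFn_toLp

lemma qSq_fourierIso (φ : WaveSpace) : qSq (fourierIso φ) = fourierError φ := by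
  rw [qSq, fourierError]
  refine lintegral_congr_ae ?_
  filter_upwards [fourierIso_coeFn φ] with l h
  rw [h]

/-- The multiplication formula for the Fourier transform on `L²`. -/
lemma integral_mul_hat (φ : WaveSpace) (η : SchwartzMap ℝ ℂ) :
    ∫ w, η w * hat φ w = ∫ l, (𝓕 η) l * φ l := by
  have h := congrArg (fun D => D η) (Lp.fourier_toTemperedDistribution_eq (lebesgueL2 φ))
  simp only [TemperedDistribution.fourier_apply, Lp.toTemperedDistribution_apply,
    smul_eq_mul] at h
  rw [hat, ← h]
  refine integral_congr_ae ?_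
  filter_upwards [lebesgueL2_coeFn φ] with l hl
  rw [hl]

/-- Identities for the L² transform are checked against test functions, since the transform has no
pointwise formula there; `integral_mul_hat` moves it onto the test function. -/
lemma ae_eq_of_integral_schwartz_mul_eq {u v : ℝ → ℂ} (hu : LocallyIntegrable u)
    (hv : LocallyIntegrable v)
    (h : ∀ η : SchwartzMap ℝ ℂ, HasCompactSupport η → ∫ w, η w * u w = ∫ w, η w * v w) :
    ∀ᵐ w : ℝ, u w = v w := by
  refine ae_eq_of_integral_contDiff_smul_eq hu hv fun g hg hs => ?_
  have h1 : ContDiff ℝ ∞ fun w => (g w : ℂ) := Complex.ofRealCLM.contDiff.comp hg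
  have h2 : HasCompactSupport fun w => (g w : ℂ) := hs.comp_left (g := fun r : ℝ => (r : ℂ)) rfl
  have h3 := h (h2.toSchwartzMap h1) h2
  simpa using h3

lemma locallyIntegrable_hat (φ : WaveSpace) : LocallyIntegrable (hat φ) :=
  (Lp.memLp (hat φ)).locallyIntegrable (by norm_num)

lemma fourier_comp_add (f : ℝ → ℂ) (a w : ℝ) :
    𝓕 (fun x => f (x + a)) w = Complex.exp (2 * Real.pi * Complex.I * a * w) * 𝓕 f w := by
  rw [Real.fourier_real_eq_integral_exp_smul, Real.fourier_real_eq_integral_exp_smul,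
    ← integral_const_mul,
    ← integral_add_right_eq_self (fun x => Complex.exp (2 * Real.pi * Complex.I * a * w) *
      (Complex.exp ((-2 * Real.pi * x * w : ℝ) * Complex.I) • f x)) a]
  refine integral_congr_ae (Filter.Eventually.of_forall fun x => ?_)
  simp only [smul_eq_mul]
  rw [← mul_assoc, ← Complex.exp_add]
  congr 2
  push_cast
  ring

/-- Modulation becomes translation. In the paired form, the translation falls on a Schwartz
function, whose transform acquires the character pointwise. -/
lemma hat_rep (s : ℝ) (φ : WaveSpace) :
    ∀ᵐ w : ℝ, hat (rep s φ) w = hat φ (w - s / (2 * Real.pi)) := by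
  set a := s / (2 * Real.pi) with ha
  have hv : LocallyIntegrable fun w => hat φ (w - a) :=
    ((Lp.memLp (hat φ)).comp_measurePreserving
      (measurePreserving_sub_right volume a)).locallyIntegrable (by norm_num)
  refine ae_eq_of_integral_schwartz_mul_eq (locallyIntegrable_hat _) hv fun η _ => ?_
  rw [integral_mul_hat, ← integral_add_right_eq_self (fun w => η w * hat φ (w - a)) a]
  have h := integral_mul_hat φ (η.compSubConstCLM ℂ (-a))
  simp only [SchwartzMap.compSubConstCLM_apply, sub_neg_eq_add] at h
  simp only [add_sub_cancel_right]
  rw [h]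
  refine integral_congr_ae ?_
  filter_upwards [ae_nu_iff.1 (rep_coeFn s φ)] with l hl
  have e : (𝓕 (η.compSubConstCLM ℂ (-a)) : SchwartzMap ℝ ℂ) l =
      Complex.exp (2 * Real.pi * Complex.I * a * l) * (𝓕 η : SchwartzMap ℝ ℂ) l := by
    rw [SchwartzMap.fourier_coe, SchwartzMap.fourier_coe, ← fourier_comp_add]
    exact congrArg (fun f : ℝ → ℂ => 𝓕 f l) (funext fun x => by simp)
  have e2 : 2 * Real.pi * Complex.I * a * l = Complex.I * (l * s : ℝ) := by
    rw [ha]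
    have : (Real.pi : ℂ) ≠ 0 := by exact_mod_cast Real.pi_ne_zero
    push_cast
    field_simp
  rw [e, hl, e2]
  ring

lemma fourierIso_rep (s : ℝ) (φ : WaveSpace) :
    ∀ᵐ g ∂nu, fourierIso (rep s φ) g = fourierIso φ (g - s) := by
  have h := (nu_add_right (-s)).quasiMeasurePreserving.ae (fourierIso_coeFn φ)
  filter_upwards [fourierIso_coeFn (rep s φ), h, ae_nu_div (hat_rep s φ)] with g h1 h2 h3
  rw [h1, sub_eq_add_neg, h2, invFourier_eq, invFourier_eq, h3]
  congr 3
  ring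

/-! ### The Gaussian -/

/-- On `L¹ ∩ L²` the Fourier transform is given by the integral. -/
lemma hat_eq_fourier {φ : WaveSpace} {f : ℝ → ℂ} (hf : Integrable f) (h : ∀ᵐ l : ℝ, φ l = f l) :
    ∀ᵐ w : ℝ, hat φ w = 𝓕 f w := by
  have hc : Continuous (𝓕 f) :=
    VectorFourier.fourierIntegral_continuous Real.continuous_fourierChar (L := innerₗ ℝ)
      continuous_inner hf
  refine ae_eq_of_integral_schwartz_mul_eq (locallyIntegrable_hat _) hc.locallyIntegrable
    fun η _ => ?_
  rw [integral_mul_hat]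
  have h1 := VectorFourier.integral_fourierIntegral_smul_eq_flip (L := innerₗ ℝ)
    Real.continuous_fourierChar continuous_inner η.integrable hf (μ := volume) (ν := volume)
  have h2 : ∫ l, (𝓕 η) l * φ l = ∫ l, 𝓕 (η : ℝ → ℂ) l * f l := by
    refine integral_congr_ae ?_
    filter_upwards [h] with l hl
    rw [hl, SchwartzMap.fourier_coe]
  rw [h2]
  simpa using! h1

lemma gaussian_fourier_const {E : ℝ} (hE : 0 < E) :
    1 / Real.sqrt (2 * Real.pi) * (E ^ (-(1 / 4) : ℝ) * Real.sqrt (Real.pi * (4 * E))) =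
      (4 * E) ^ (1 / 4 : ℝ) := by
  have h1 : Real.sqrt (Real.pi * (4 * E)) = Real.sqrt (2 * Real.pi) * Real.sqrt (2 * E) := by
    rw [← Real.sqrt_mul (by positivity)]
    ring_nf
  have h2 : E ^ (-(1 / 4) : ℝ) * Real.sqrt (2 * E) = (4 * E) ^ (1 / 4 : ℝ) := by
    rw [Real.sqrt_eq_rpow, Real.mul_rpow (by norm_num) hE.le, Real.mul_rpow (by norm_num) hE.le,
      mul_left_comm, ← Real.rpow_add hE, show (4 : ℝ) = 2 ^ (2 : ℝ) by norm_num,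
      ← Real.rpow_mul (by norm_num)]
    norm_num
  have h3 : Real.sqrt (2 * Real.pi) ≠ 0 := by positivity
  rw [h1, ← h2]
  field_simp

lemma invFourier_gaussian {E : ℝ} (hE : 0 < E) {φ : WaveSpace}
    (h : ∀ᵐ l ∂nu, φ l = (gaussian E l : ℂ)) :
    ∀ᵐ g ∂nu, invFourier φ g =
      (((4 * E) ^ (1 / 4 : ℝ) * Real.exp (-E * g ^ 2) : ℝ) : ℂ) := by
  have hg : (fun l : ℝ => (gaussian E l : ℂ)) = fun l : ℝ =>
      ((E ^ (-(1 / 4) : ℝ) : ℝ) : ℂ) * Complex.exp (-((1 / (4 * E) : ℝ) : ℂ) * l ^ 2) := by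
    ext l
    rw [gaussian]
    push_cast
    congr 2
    ring
  have hb : 0 < ((1 / (4 * E) : ℝ) : ℂ).re := by
    rw [Complex.ofReal_re]
    positivity
  have hi : Integrable fun l : ℝ => (gaussian E l : ℂ) := by
    rw [hg]
    exact (integrable_cexp_neg_mul_sq hb).const_mul _
  filter_upwards [ae_nu_div (hat_eq_fourier hi (ae_nu_iff.1 h))] with g hg1
  rw [invFourier_eq, hg1, Real.fourier_real_eq_integral_exp_smul]
  have e : ∀ l : ℝ, Complex.exp ((-2 * Real.pi * l * (g / (2 * Real.pi)) : ℝ) * Complex.I) •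
      (gaussian E l : ℂ) = ((E ^ (-(1 / 4) : ℝ) : ℝ) : ℂ) *
        (Complex.exp (Complex.I * (-g : ℝ) * l) *
          Complex.exp (-((1 / (4 * E) : ℝ) : ℂ) * l ^ 2)) := by
    intro l
    rw [congrFun hg l, smul_eq_mul, mul_left_comm]
    congr 3
    have : (Real.pi : ℂ) ≠ 0 := by exact_mod_cast Real.pi_ne_zero
    push_cast
    field_simp
  simp only [e]
  rw [integral_const_mul, fourierIntegral_gaussian hb]
  have e1 : ((Real.pi : ℂ) / ((1 / (4 * E) : ℝ) : ℂ)) ^ (1 / 2 : ℂ) =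
      ((Real.sqrt (Real.pi * (4 * E)) : ℝ) : ℂ) := by
    rw [Real.sqrt_eq_rpow, Complex.ofReal_cpow (by positivity)]
    push_cast
    rw [div_div_eq_mul_div, div_one]
  have e2 : -(((-g : ℝ) : ℂ)) ^ 2 / (4 * ((1 / (4 * E) : ℝ) : ℂ)) = ((-E * g ^ 2 : ℝ) : ℂ) := by
    have : (E : ℂ) ≠ 0 := by exact_mod_cast hE.ne'
    push_cast
    field_simp
  rw [e1, e2, ← Complex.ofReal_exp, ← Complex.ofReal_mul, ← Complex.ofReal_mul,
    ← Complex.ofReal_mul, ← gaussian_fourier_const hE]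
  congr 1
  ring

lemma lintegral_sq_gaussian {E : ℝ} (hE : 0 < E) :
    ∫⁻ l, ENNReal.ofReal (l ^ 2 * gaussian E l ^ 2) ∂nu = ENNReal.ofReal E := by
  have hm : Measurable fun l => ENNReal.ofReal (gaussian E l ^ 2) := by
    unfold gaussian
    fun_prop
  have h1 : ∫⁻ l, ENNReal.ofReal (l ^ 2) ∂(ProbabilityTheory.gaussianReal 0 E.toNNReal) =
      ENNReal.ofReal E := by
    have hL : Integrable (fun l : ℝ => l ^ 2) (ProbabilityTheory.gaussianReal 0 E.toNNReal) :=
      (ProbabilityTheory.memLp_id_gaussianReal 2).integrable_sq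
    rw [← ofReal_integral_eq_lintegral_ofReal hL
      (Filter.Eventually.of_forall fun _ => by positivity)]
    have hv := ProbabilityTheory.variance_fun_id_gaussianReal (μ := 0) (v := E.toNNReal)
    rw [ProbabilityTheory.variance_eq_integral (by fun_prop),
      ProbabilityTheory.integral_id_gaussianReal] at hv
    simp only [sub_zero] at hv
    rw [hv, Real.coe_toNNReal E hE.le]
  rw [gaussianReal_eq_nu hE, lintegral_withDensity_eq_lintegral_mul _ hm (by fun_prop)] at h1
  rw [← h1]
  refine lintegral_congr fun l => ?_
  rw [Pi.mul_apply, ← ENNReal.ofReal_mul (by positivity), mul_comm]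

lemma lintegral_gaussian_sq {E : ℝ} (hE : 0 < E) :
    ∫⁻ l, ENNReal.ofReal (gaussian E l ^ 2) ∂nu = 1 := by
  have h := congrArg (fun μ : Measure ℝ => μ Set.univ) (gaussianReal_eq_nu hE)
  simp only [measure_univ, withDensity_apply _ MeasurableSet.univ, setLIntegral_univ] at h
  exact h.symm

lemma qSq_of_norm_eq_gaussian {E : ℝ} (hE : 0 < E) {φ : WaveSpace}
    (h : ∀ᵐ l ∂nu, ‖φ l‖ = gaussian E l) : qSq φ = ENNReal.ofReal E := by
  rw [← lintegral_sq_gaussian hE, qSq]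
  refine lintegral_congr_ae ?_
  filter_upwards [h] with l hl
  rw [hl]

lemma norm_of_norm_eq_gaussian {E : ℝ} (hE : 0 < E) {φ : WaveSpace}
    (h : ∀ᵐ l ∂nu, ‖φ l‖ = gaussian E l) : ‖φ‖ = 1 := by
  have h1 : ENNReal.ofReal (‖φ‖ ^ 2) = ENNReal.ofReal 1 := by
    rw [ENNReal.ofReal_one, ← lintegral_gaussian_sq hE, ofReal_norm_sq_eq_lintegral]
    refine lintegral_congr_ae ?_
    filter_upwards [h] with l hl
    rw [hl]
  have h2 := (ENNReal.ofReal_eq_ofReal_iff (by positivity) (by positivity)).1 h1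
  exact (pow_eq_one_iff_of_nonneg (norm_nonneg _) two_ne_zero).1 h2

lemma norm_eq_gaussian {E : ℝ} (hE : 0 < E) {φ : WaveSpace}
    (h : ∀ᵐ l ∂nu, φ l = (gaussian E l : ℂ)) : ∀ᵐ l ∂nu, ‖φ l‖ = gaussian E l := by
  filter_upwards [h] with l hl
  rw [hl, Complex.norm_real, Real.norm_of_nonneg (gaussian_pos hE l).le]

lemma exists_gaussian {E : ℝ} (hE : 0 < E) :
    ∃ γ : WaveSpace, ∀ᵐ l ∂nu, γ l = (gaussian E l : ℂ) := by
  have hm : Measurable fun l => (gaussian E l : ℂ) := by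
    unfold gaussian
    fun_prop
  have hL : MemLp (fun l => (gaussian E l : ℂ)) 2 nu := by
    rw [memLp_two_iff_integrable_sq_norm hm.aestronglyMeasurable]
    refine ⟨(hm.norm.pow_const 2).aestronglyMeasurable, ?_⟩
    rw [hasFiniteIntegral_iff_ofReal (Filter.Eventually.of_forall fun l => by positivity)]
    simp only [Complex.norm_real, Real.norm_eq_abs, sq_abs]
    rw [lintegral_gaussian_sq hE]
    exact ENNReal.one_lt_top
  exact ⟨hL.toLp _, hL.coeFn_toLp⟩

/-- The transform of φ_E is the same Gaussian with parameter 1/(4E), so its second moment is already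
known. -/
lemma fourierError_gaussian {E : ℝ} (hE : 0 < E) {φ : WaveSpace}
    (h : ∀ᵐ l ∂nu, φ l = (gaussian E l : ℂ)) :
    fourierError φ = ENNReal.ofReal (1 / (4 * E)) := by
  have hE' : 0 < 1 / (4 * E) := by positivity
  rw [← qSq_fourierIso]
  refine qSq_of_norm_eq_gaussian hE' (norm_eq_gaussian hE' ?_)
  filter_upwards [fourierIso_coeFn φ, invFourier_gaussian hE h] with g h1 h2
  rw [h1, h2, gaussian]
  congr 2
  · rw [one_div (4 * E), Real.inv_rpow (by positivity), Real.rpow_neg (by positivity), inv_inv]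
  · congr 1
    field_simp


/-! ### The momentum operator -/

lemma integral_nu (f : ℝ → ℂ) : ∫ l, f l ∂nu =
    ((1 / Real.sqrt (2 * Real.pi) : ℝ) : ℂ) * ∫ l, f l := by
  rw [nu, integral_smul_measure, ENNReal.toReal_ofReal (by positivity), Complex.real_smul]

lemma integrable_wave_mul_schwartz (φ : WaveSpace) (η : SchwartzMap ℝ ℂ) :
    Integrable (fun l => φ l * η l) nu :=
  (Lp.memLp φ).integrable_mul ((η.memLp 2 volume).smul_measure ENNReal.ofReal_ne_top)

/-- The weak form of `ψ = P φ` extends to Schwartz functions. -/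
lemma IsMomentum.integral_schwartz {φ ψ : WaveSpace} (h : IsMomentum φ ψ)
    (η : SchwartzMap ℝ ℂ) :
    ∫ l, ψ l * η l ∂nu = Complex.I * ∫ l, φ l * deriv η l ∂nu := by
  -- The cutoffs b(cₙx) with cₙ = 1/(n+1) tend to 1. The product rule adds cₙ b′(cₙx) η, which tends
  -- to 0 and is dominated because b′ is bounded.
  let b : ContDiffBump (0 : ℝ) := ⟨1, 2, by norm_num, by norm_num⟩
  have hb : ContDiff ℝ ∞ b := b.contDiff
  have hbd : Differentiable ℝ b := hb.differentiable (by simp)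
  have hb1 : ∀ x, ‖((b x : ℝ) : ℂ)‖ ≤ 1 := fun x => by
    rw [Complex.norm_real, Real.norm_of_nonneg b.nonneg]
    exact b.le_one
  obtain ⟨C, hC⟩ : ∃ C, ∀ x, ‖deriv b x‖ ≤ C :=
    (hb.continuous_deriv (by simp)).bounded_above_of_compact_support b.hasCompactSupport.deriv
  have hC0 : 0 ≤ C := (norm_nonneg _).trans (hC 0)
  let c : ℕ → ℝ := fun n => ((n : ℝ) + 1)⁻¹
  have hc0 : ∀ n, 0 < c n := fun n => by positivity
  have hc1 : ∀ n, c n ≤ 1 := fun n => inv_le_one_of_one_le₀ (by linarith [n.cast_nonneg (α := ℝ)])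
  have hct : Filter.Tendsto c Filter.atTop (nhds 0) := by
    simpa [c] using tendsto_one_div_add_atTop_nhds_zero_nat (𝕜 := ℝ)
  let χ : ℕ → ℝ → ℂ := fun n x => ((b (c n * x) : ℝ) : ℂ)
  have hχ : ∀ n, ContDiff ℝ ∞ (χ n) := fun n =>
    Complex.ofRealCLM.contDiff.comp (hb.comp (contDiff_const.mul contDiff_id))
  have hχd : ∀ n x, HasDerivAt (χ n) ((deriv b (c n * x) * c n : ℝ) : ℂ) x := by
    intro n x
    have h1 : HasDerivAt (fun x => c n * x) (c n) x := by
      simpa using (hasDerivAt_id x).const_mul (c n)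
    exact ((hbd _).hasDerivAt.comp x h1).ofReal_comp
  have hχs : ∀ n, HasCompactSupport (χ n) := by
    intro n
    have h1 : HasCompactSupport fun x => b (c n * x) :=
      b.hasCompactSupport.comp_homeomorph (Homeomorph.mulLeft₀ (c n) (hc0 n).ne')
    exact h1.comp_left (g := fun r : ℝ => (r : ℂ)) rfl
  have hη := η.smooth ⊤
  have key : ∀ n, ∫ l, ψ l * (χ n l * η l) ∂nu = Complex.I *
      ∫ l, φ l * (((deriv b (c n * l) * c n : ℝ) : ℂ) * η l + χ n l * deriv η l) ∂nu := by
    intro n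
    have h1 := h (fun l => χ n l * η l) ((hχ n).mul hη) ((hχs n).mul_right)
    rw [h1]
    congr 2
    ext l
    exact congrArg (φ l * ·) ((hχd n l).mul (η.differentiable l).hasDerivAt).deriv
  have lim : ∀ x : ℝ, Filter.Tendsto (fun n => c n * x) Filter.atTop (nhds 0) := fun x => by
    simpa using hct.mul_const x
  have limχ : ∀ x, Filter.Tendsto (fun n => χ n x) Filter.atTop (nhds 1) := by
    intro x
    have h1 := (hb.continuous.tendsto 0).comp (lim x)
    have h2 : b 0 = 1 := b.one_of_mem_closedBall (by simp [b])
    rw [h2] at h1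
    exact (Complex.continuous_ofReal.tendsto 1).comp h1
  have limd : ∀ x, Filter.Tendsto (fun n => ((deriv b (c n * x) * c n : ℝ) : ℂ)) Filter.atTop
      (nhds 0) := by
    intro x
    have h1 := (((hb.continuous_deriv (by simp)).tendsto 0).comp (lim x)).mul hct
    rw [mul_zero] at h1
    exact (Complex.continuous_ofReal.tendsto 0).comp h1
  have hcont : ∀ n, Continuous fun x => ((deriv b (c n * x) * c n : ℝ) : ℂ) := fun n =>
    Complex.continuous_ofReal.comp (((hb.continuous_deriv (by simp)).comp
      (continuous_const.mul continuous_id)).mul continuous_const)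
  let η' := SchwartzMap.derivCLM ℂ ℂ η
  have hη' : ∀ x, η' x = deriv η x := fun x => SchwartzMap.derivCLM_apply ℂ η x
  have l1 : Filter.Tendsto (fun n => ∫ l, ψ l * (χ n l * η l) ∂nu) Filter.atTop
      (nhds (∫ l, ψ l * η l ∂nu)) := by
    refine tendsto_integral_of_dominated_convergence (fun l => ‖ψ l * η l‖) (fun n => ?_)
      (integrable_wave_mul_schwartz ψ η).norm (fun n => ?_) ?_
    · exact (Lp.aestronglyMeasurable ψ).mul
        ((hχ n).continuous.mul η.continuous).aestronglyMeasurable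
    · refine Filter.Eventually.of_forall fun l => ?_
      rw [norm_mul, norm_mul, norm_mul]
      gcongr
      exact mul_le_of_le_one_left (norm_nonneg _) (hb1 _)
    · refine Filter.Eventually.of_forall fun l => ?_
      simpa using ((limχ l).mul_const (η l)).const_mul (ψ l)
  have l2 : Filter.Tendsto (fun n => ∫ l, φ l * (((deriv b (c n * l) * c n : ℝ) : ℂ) * η l +
      χ n l * deriv η l) ∂nu) Filter.atTop (nhds (∫ l, φ l * deriv η l ∂nu)) := by
    refine tendsto_integral_of_dominated_convergence
      (fun l => C * ‖φ l * η l‖ + ‖φ l * η' l‖) (fun n => ?_)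
      (((integrable_wave_mul_schwartz φ η).norm.const_mul C).add
        (integrable_wave_mul_schwartz φ η').norm) (fun n => ?_) ?_
    · simp only [← hη']
      exact (Lp.aestronglyMeasurable φ).mul (((hcont n).mul η.continuous).add
        ((hχ n).continuous.mul η'.continuous)).aestronglyMeasurable
    · refine Filter.Eventually.of_forall fun l => ?_
      rw [← hη', norm_mul, norm_mul, norm_mul]
      have h1 : ‖((deriv b (c n * l) * c n : ℝ) : ℂ) * η l + χ n l * η' l‖ ≤
          C * ‖η l‖ + ‖η' l‖ := by
        refine (norm_add_le _ _).trans ?_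
        rw [norm_mul, norm_mul, Complex.norm_real, norm_mul]
        refine add_le_add ?_ (mul_le_of_le_one_left (norm_nonneg _) (hb1 _))
        gcongr
        rw [Real.norm_of_nonneg (hc0 n).le]
        calc _ ≤ C * 1 := mul_le_mul (hC _) (hc1 n) (hc0 n).le hC0
          _ = C := mul_one C
      calc _ ≤ ‖φ l‖ * (C * ‖η l‖ + ‖η' l‖) := by gcongr
        _ = _ := by ring
    · refine Filter.Eventually.of_forall fun l => ?_
      simpa using (((limd l).mul_const (η l)).add ((limχ l).mul_const (deriv η l))).const_mul (φ l)
  have l3 := l2.const_mul Complex.I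
  simp only [← key] at l3
  exact tendsto_nhds_unique l1 l3

/-- Pairing ψ̂ with η is pairing ψ with 𝓕η, where the weak derivative acts. As 𝓕η is not in general
compactly supported, the extension to Schwartz functions is needed. -/
lemma IsMomentum.hat_eq {φ ψ : WaveSpace} (h : IsMomentum φ ψ) :
    ∀ᵐ w : ℝ, hat ψ w = (2 * Real.pi * w : ℝ) * hat φ w := by
  have hv : LocallyIntegrable fun w : ℝ => ((2 * Real.pi * w : ℝ) : ℂ) * hat φ w :=
    (locallyIntegrable_hat φ).continuous_mul (by fun_prop)
  refine ae_eq_of_integral_schwartz_mul_eq (locallyIntegrable_hat ψ) hv fun η hs => ?_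
  -- The derivative of 𝓕η is the transform of −2πi x η, which is again a test function because η has
  -- compact support.
  have hm : ContDiff ℝ ∞ fun x : ℝ => -2 * Real.pi * Complex.I * (x : ℂ) * η x := by
    have : ContDiff ℝ ∞ fun x : ℝ => (x : ℂ) := Complex.ofRealCLM.contDiff
    exact (contDiff_const.mul this).mul (η.smooth ⊤)
  have hms : HasCompactSupport fun x : ℝ => -2 * Real.pi * Complex.I * (x : ℂ) * η x :=
    hs.mul_left
  set ζ : SchwartzMap ℝ ℂ := hms.toSchwartzMap hm with hζ
  have hζx : ∀ x, ζ x = -2 * Real.pi * Complex.I * (x : ℂ) * η x := fun x => rfl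
  have hd : deriv (𝓕 η : SchwartzMap ℝ ℂ) = (𝓕 ζ : SchwartzMap ℝ ℂ) := by
    rw [SchwartzMap.fourier_coe, SchwartzMap.fourier_coe, Real.deriv_fourier η.integrable]
    · rfl
    · have hc : Continuous fun x : ℝ => (x : ℂ) * η x := Complex.continuous_ofReal.mul η.continuous
      have hi := hc.integrable_of_hasCompactSupport (μ := volume) hs.mul_left
      simpa only [Complex.real_smul] using hi
  have h1 := h.integral_schwartz (𝓕 η)
  rw [hd, integral_nu, integral_nu, mul_left_comm] at h1
  have hc : ((1 / Real.sqrt (2 * Real.pi) : ℝ) : ℂ) ≠ 0 := by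
    rw [ne_eq, Complex.ofReal_eq_zero]
    positivity
  have h2 := mul_left_cancel₀ hc h1
  simp only [mul_comm (ψ _), mul_comm (φ _)] at h2
  rw [integral_mul_hat, h2, ← integral_mul_hat, ← integral_const_mul]
  refine integral_congr_ae (Filter.Eventually.of_forall fun w => ?_)
  simp only [hζx]
  push_cast
  linear_combination (-2 * Real.pi * w * η w * hat φ w) * Complex.I_mul_I

lemma IsMomentum.fourierError_eq {φ ψ : WaveSpace} (h : IsMomentum φ ψ) :
    fourierError φ = ENNReal.ofReal (‖ψ‖ ^ 2) := by
  rw [← lintegral_norm_invFourier_sq, fourierError]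
  refine lintegral_congr_ae ?_
  filter_upwards [ae_nu_div h.hat_eq] with g hg
  have e : invFourier ψ g = (g : ℂ) * invFourier φ g := by
    have : (Real.pi : ℂ) ≠ 0 := by exact_mod_cast Real.pi_ne_zero
    rw [invFourier_eq, invFourier_eq, hg]
    push_cast
    field_simp
  rw [e, norm_mul, mul_pow, Complex.norm_real, Real.norm_eq_abs, sq_abs]

/-- This inequality is enough for the lower bound in the momentum problem. Equality is used only at
Gaussians, where an explicit momentum vector yields it. -/
lemma fourierError_le_pSq (φ : WaveSpace) : fourierError φ ≤ pSq φ :=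
  le_iInf₂ fun _ h => h.fourierError_eq.le

/-- The witness comes from φ_E′ = −(l/2E) φ_E, hence Pφ = −iφ′ = (i/2E) Qφ. -/
lemma isMomentum_gaussian {E : ℝ} (hE : 0 < E) {φ : WaveSpace} {c : ℂ}
    (h : ∀ᵐ l ∂nu, φ l = c * (gaussian E l : ℂ)) (hq : qSq φ ≠ ⊤) :
    IsMomentum φ ((Complex.I * (1 / (2 * E) : ℝ)) • position φ hq) := by
  intro η hη hs
  have hd : ∀ l, HasDerivAt (fun l => (gaussian E l : ℂ))
      ((-(l / (2 * E)) * gaussian E l : ℝ) : ℂ) l := by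
    intro l
    refine HasDerivAt.ofReal_comp ?_
    have h1 : HasDerivAt (fun l : ℝ => -l ^ 2 / (4 * E)) (-(l / (2 * E))) l :=
      ((hasDerivAt_pow 2 l).neg.div_const (4 * E)).congr_deriv (by norm_num; field_simp; ring)
    exact (h1.exp.const_mul (E ^ (-(1 / 4) : ℝ))).congr_deriv (by rw [gaussian]; ring)
  have hγ : Continuous fun l => (gaussian E l : ℂ) :=
    continuous_iff_continuousAt.2 fun l => (hd l).continuousAt
  have hγ' : Continuous fun l => ((-(l / (2 * E)) * gaussian E l : ℝ) : ℂ) := by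
    unfold gaussian
    fun_prop
  have hη' : ∀ l, HasDerivAt η (deriv η l) l := fun l =>
    (hη.differentiable (by simp) l).hasDerivAt
  have hp := integral_mul_deriv_eq_deriv_mul_of_integrable (fun l _ => hd l) (fun l _ => hη' l)
    ((hγ.mul (hη.continuous_deriv (by simp))).integrable_of_hasCompactSupport hs.deriv.mul_left)
    ((hγ'.mul hη.continuous).integrable_of_hasCompactSupport hs.mul_left)
    ((hγ.mul hη.continuous).integrable_of_hasCompactSupport hs.mul_left)
  have e1 : ∫ l, φ l * deriv η l ∂nu = c * ∫ l, (gaussian E l : ℂ) * deriv η l ∂nu := by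
    rw [← integral_const_mul]
    refine integral_congr_ae ?_
    filter_upwards [h] with l hl
    rw [hl, mul_assoc]
  have e2 : ∫ l, ((Complex.I * (1 / (2 * E) : ℝ)) • position φ hq) l * η l ∂nu =
      -(Complex.I * c) * ∫ l, ((-(l / (2 * E)) * gaussian E l : ℝ) : ℂ) * η l ∂nu := by
    rw [← integral_const_mul]
    refine integral_congr_ae ?_
    filter_upwards [h, position_coeFn φ hq,
      Lp.coeFn_smul (Complex.I * (1 / (2 * E) : ℝ)) (position φ hq)] with l h1 h2 h3
    rw [h3, Pi.smul_apply, h2, h1, smul_eq_mul]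
    push_cast
    ring
  rw [e1, e2, integral_nu, integral_nu, hp]
  ring

lemma pSq_gaussian_le {E : ℝ} (hE : 0 < E) {φ : WaveSpace} {c : ℂ}
    (h : ∀ᵐ l ∂nu, φ l = c * (gaussian E l : ℂ)) (hq : qSq φ ≤ ENNReal.ofReal E) :
    pSq φ ≤ ENNReal.ofReal (1 / (4 * E)) := by
  have hq' : qSq φ ≠ ⊤ := ne_top_of_le_ne_top ENNReal.ofReal_ne_top hq
  refine (iInf₂_le _ (isMomentum_gaussian hE h hq')).trans ?_
  refine ENNReal.ofReal_le_ofReal ?_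
  rw [qSq_eq_norm_position φ hq', ENNReal.ofReal_le_ofReal_iff hE.le] at hq
  rw [norm_smul, norm_mul, Complex.norm_I, Complex.norm_real, Real.norm_of_nonneg (by positivity),
    one_mul, mul_pow]
  calc _ ≤ (1 / (2 * E)) ^ 2 * E := by gcongr
    _ = _ := by field_simp; norm_num

/-! ### Phases -/

/-- Multiplication by a unimodular function. -/
noncomputable def phaseIso (u : ℝ → ℂ) (hu : MemLp u ⊤ nu) (h1 : ∀ᵐ l ∂nu, ‖u l‖ = 1) :
    WaveSpace →ₗᵢ[ℂ] WaveSpace where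
  toLinearMap := (mulOp u hu).toLinearMap
  norm_map' x := by
    have h : ENNReal.ofReal (‖mulOp u hu x‖ ^ 2) = ENNReal.ofReal (‖x‖ ^ 2) := by
      rw [ofReal_norm_sq_eq_lintegral, ofReal_norm_sq_eq_lintegral]
      refine lintegral_congr_ae ?_
      filter_upwards [mulOp_coeFn u hu x, h1] with l h2 h3
      rw [h2, norm_mul, h3, one_mul]
    have h2 := (ENNReal.ofReal_eq_ofReal_iff (by positivity) (by positivity)).1 h
    exact (pow_left_inj₀ (norm_nonneg _) (norm_nonneg _) two_ne_zero).1 h2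

lemma mulOp_rep (u : ℝ → ℂ) (hu : MemLp u ⊤ nu) (s : ℝ) (x : WaveSpace) :
    mulOp u hu (rep s x) = rep s (mulOp u hu x) := by
  apply Lp.ext
  filter_upwards [mulOp_coeFn u hu x, mulOp_coeFn u hu (rep s x), rep_coeFn s x,
    rep_coeFn s (mulOp u hu x)] with l h1 h2 h3 h4
  rw [h2, h4, h1, h3]
  ring

/-- For a Gaussian up to a phase there is a covariant measurement of minimal error. -/
lemma exists_povm_of_norm_eq_gaussian {E : ℝ} (hE : 0 < E) {φ : WaveSpace}
    (h : ∀ᵐ l ∂nu, ‖φ l‖ = gaussian E l) :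
    ∃ M : POVM WaveSpace, M.IsCovariant ∧
      M.secondMoment φ = ENNReal.ofReal (1 / (4 * E)) := by
  -- Multiplication by `u` turns φ into the positive Gaussian and commutes with the representation,
  -- so applying it before the Fourier transform keeps covariance.
  set u : ℝ → ℂ := fun l => (gaussian E l : ℂ) / φ l with hu
  have h1 : ∀ᵐ l ∂nu, ‖u l‖ = 1 := by
    filter_upwards [h] with l hl
    rw [hu]
    simp only
    rw [norm_div, hl, Complex.norm_real, Real.norm_of_nonneg (gaussian_pos hE l).le,
      div_self (gaussian_pos hE l).ne']
  have hm : AEStronglyMeasurable u nu := by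
    have hg : Measurable fun l => (gaussian E l : ℂ) := by
      unfold gaussian
      fun_prop
    exact (hg.aemeasurable.div (Lp.aestronglyMeasurable φ).aemeasurable).aestronglyMeasurable
  have hL : MemLp u ⊤ nu := memLp_top_of_bound hm 1 (h1.mono fun l hl => hl.le)
  refine ⟨isoPOVM (fourierIso.comp (phaseIso u hL h1)), isoPOVM_isCovariant fun s x => ?_, ?_⟩
  · have e : phaseIso u hL h1 (rep s x) = rep s (phaseIso u hL h1 x) := mulOp_rep u hL s x
    have e2 := fourierIso_rep s (phaseIso u hL h1 x)
    rw [← e] at e2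
    exact e2
  · rw [isoPOVM_secondMoment]
    refine (qSq_fourierIso (phaseIso u hL h1 φ)).trans (fourierError_gaussian hE ?_)
    filter_upwards [mulOp_coeFn u hL φ, h] with l h2 h3
    refine h2.trans ?_
    have : φ l ≠ 0 := by
      rw [← norm_ne_zero_iff, h3]
      exact (gaussian_pos hE l).ne'
    rw [hu]
    exact div_mul_cancel₀ _ this


/-! ### Minimisation under the energy constraint -/

section Arithmetic

variable {E : ℝ} (hE : 0 < E) {e d : ℝ≥0∞}

include hE

/-- The weights 1/(2E) and 2E act as multipliers, balanced so that at the optimum both terms of the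
cost equal 1/2. -/
lemma energy_term_le (he : e ≤ ENNReal.ofReal E) :
    ENNReal.ofReal (1 / (2 * E)) * e ≤ ENNReal.ofReal (1 / 2) := by
  calc _ ≤ ENNReal.ofReal (1 / (2 * E)) * ENNReal.ofReal E := by gcongr
    _ = _ := by
      rw [← ENNReal.ofReal_mul (by positivity)]
      congr 1
      field_simp

lemma error_term_eq : ENNReal.ofReal (2 * E) * ENNReal.ofReal (1 / (4 * E)) =
    ENNReal.ofReal (1 / 2) := by
  rw [← ENNReal.ofReal_mul (by positivity)]
  congr 1
  field_simp
  norm_num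

lemma half_add_half : ENNReal.ofReal (1 / 2) + ENNReal.ofReal (1 / 2) = 1 := by
  rw [← ENNReal.ofReal_add (by norm_num) (by norm_num)]
  norm_num

lemma le_of_one_le_cost (he : e ≤ ENNReal.ofReal E)
    (h : 1 ≤ ENNReal.ofReal (1 / (2 * E)) * e + ENNReal.ofReal (2 * E) * d) :
    ENNReal.ofReal (1 / (4 * E)) ≤ d := by
  by_contra! hd
  have h1 : ENNReal.ofReal (2 * E) * d < ENNReal.ofReal (1 / 2) := by
    rw [← error_term_eq hE]
    exact ENNReal.mul_lt_mul_right (by simp [hE]) ENNReal.ofReal_ne_top hd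
  have h2 := ENNReal.add_lt_add_of_le_of_lt (ne_top_of_le_ne_top ENNReal.ofReal_ne_top
    (energy_term_le hE he)) (energy_term_le hE he) h1
  rw [half_add_half hE] at h2
  exact absurd h (not_le.2 h2)

lemma cost_le_one (he : e ≤ ENNReal.ofReal E) (hd : d ≤ ENNReal.ofReal (1 / (4 * E))) :
    ENNReal.ofReal (1 / (2 * E)) * e + ENNReal.ofReal (2 * E) * d ≤ 1 := by
  rw [← half_add_half hE]
  refine add_le_add (energy_term_le hE he) ?_
  rw [← error_term_eq hE]
  gcongr

end Arithmetic

section Minimum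

variable {E : ℝ} (hE : 0 < E)

include hE

/-! #### Pure states -/

/-- The covariant measurement with outcome density `|F⁻¹φ|²`. -/
noncomputable def fourierPOVM : POVM WaveSpace := isoPOVM fourierIso

omit hE in
lemma fourierPOVM_isCovariant : fourierPOVM.IsCovariant := isoPOVM_isCovariant fourierIso_rep

omit hE in
lemma fourierPOVM_secondMoment (φ : WaveSpace) : fourierPOVM.secondMoment φ = fourierError φ := by
  rw [fourierPOVM, isoPOVM_secondMoment, qSq_fourierIso]

lemma le_fourierError {φ : WaveSpace} (hφ : ‖φ‖ = 1) (hq : qSq φ ≤ ENNReal.ofReal E) :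
    ENNReal.ofReal (1 / (4 * E)) ≤ fourierError φ := by
  have h := norm_sq_le_cost hE fourierPOVM_isCovariant φ
  rw [hφ, one_pow, ENNReal.ofReal_one, cost, fourierPOVM_secondMoment] at h
  exact le_of_one_le_cost hE hq h

/-- For the Fourier measurement the Gaussian is itself an equality case, so the line of equality
cases is the one it spans; this excludes non-constant phases. -/
lemma eq_smul_gaussian {φ : WaveSpace} (hφ : ‖φ‖ = 1)
    (hc : cost E fourierPOVM φ ≤ ENNReal.ofReal (‖φ‖ ^ 2)) {γ : WaveSpace}
    (hγ : ∀ᵐ l ∂nu, γ l = (gaussian E l : ℂ)) : ∃ c : ℂ, ‖c‖ = 1 ∧ φ = c • γ := by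
  have hγ1 := norm_of_norm_eq_gaussian hE (norm_eq_gaussian hE hγ)
  have hγ0 : γ ≠ 0 := by
    rintro rfl
    simp at hγ1
  have hcγ : cost E fourierPOVM γ ≤ ENNReal.ofReal (‖γ‖ ^ 2) := by
    rw [hγ1, one_pow, ENNReal.ofReal_one, cost, fourierPOVM_secondMoment]
    exact cost_le_one hE (qSq_of_norm_eq_gaussian hE (norm_eq_gaussian hE hγ)).le
      (fourierError_gaussian hE hγ).le
  obtain ⟨c, rfl⟩ := exists_eq_smul_of_cost_le hE fourierPOVM_isCovariant hc hcγ hγ0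
  rw [norm_smul, hγ1, mul_one] at hφ
  exact ⟨c, hφ, rfl⟩

lemma exists_mul_gaussian_of_fourierError_le {φ : WaveSpace} (hφ : ‖φ‖ = 1)
    (hq : qSq φ ≤ ENNReal.ofReal E) (hf : fourierError φ ≤ ENNReal.ofReal (1 / (4 * E))) :
    ∃ c : ℂ, ‖c‖ = 1 ∧ ∀ᵐ l ∂nu, φ l = c * (gaussian E l : ℂ) := by
  obtain ⟨γ, hγ⟩ := exists_gaussian hE
  have hc : cost E fourierPOVM φ ≤ ENNReal.ofReal (‖φ‖ ^ 2) := by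
    rw [hφ, one_pow, ENNReal.ofReal_one, cost, fourierPOVM_secondMoment]
    exact cost_le_one hE hq hf
  obtain ⟨c, hc1, rfl⟩ := eq_smul_gaussian hE hφ hc hγ
  refine ⟨c, hc1, ?_⟩
  filter_upwards [Lp.coeFn_smul c γ, hγ] with l h1 h2
  rw [h1, Pi.smul_apply, h2, smul_eq_mul]

lemma norm_eq_gaussian_of_mul {φ : WaveSpace} {c : ℂ} (hc : ‖c‖ = 1)
    (h : ∀ᵐ l ∂nu, φ l = c * (gaussian E l : ℂ)) : ∀ᵐ l ∂nu, ‖φ l‖ = gaussian E l := by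
  filter_upwards [h] with l hl
  rw [hl, norm_mul, hc, one_mul, Complex.norm_real, Real.norm_of_nonneg (gaussian_pos hE l).le]

/-- The chain 1/(4E) ≤ `fourierError` ≤ `pSq` ≤ 1/(4E) closes up, giving both values at once. -/
lemma pSq_of_mul_gaussian {φ : WaveSpace} {c : ℂ} (hc : ‖c‖ = 1)
    (h : ∀ᵐ l ∂nu, φ l = c * (gaussian E l : ℂ)) :
    ‖φ‖ = 1 ∧ qSq φ ≤ ENNReal.ofReal E ∧ pSq φ = ENNReal.ofReal (1 / (4 * E)) ∧
      fourierError φ = ENNReal.ofReal (1 / (4 * E)) := by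
  have h1 := norm_eq_gaussian_of_mul hE hc h
  have hn := norm_of_norm_eq_gaussian hE h1
  have hq := (qSq_of_norm_eq_gaussian hE h1).le
  have hp := pSq_gaussian_le hE h hq
  have hf := le_fourierError hE hn hq
  have hfp := fourierError_le_pSq φ
  exact ⟨hn, hq, le_antisymm hp (hf.trans hfp), le_antisymm (hfp.trans hp) hf⟩

theorem fourierError_eq_iff (φ : WaveSpace) :
    (‖φ‖ = 1 ∧ qSq φ ≤ ENNReal.ofReal E ∧ fourierError φ = ENNReal.ofReal (1 / (4 * E))) ↔
      ∃ c : ℂ, ‖c‖ = 1 ∧ ∀ᵐ l ∂nu, φ l = c * (gaussian E l : ℂ) := by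
  refine ⟨fun ⟨h1, h2, h3⟩ => exists_mul_gaussian_of_fourierError_le hE h1 h2 h3.le, ?_⟩
  rintro ⟨c, hc, h⟩
  obtain ⟨h1, h2, -, h4⟩ := pSq_of_mul_gaussian hE hc h
  exact ⟨h1, h2, h4⟩

theorem pSq_eq_iff (φ : WaveSpace) :
    (‖φ‖ = 1 ∧ qSq φ ≤ ENNReal.ofReal E ∧ pSq φ = ENNReal.ofReal (1 / (4 * E))) ↔
      ∃ c : ℂ, ‖c‖ = 1 ∧ ∀ᵐ l ∂nu, φ l = c * (gaussian E l : ℂ) := by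
  refine ⟨fun ⟨h1, h2, h3⟩ => exists_mul_gaussian_of_fourierError_le hE h1 h2
    ((fourierError_le_pSq φ).trans h3.le), ?_⟩
  rintro ⟨c, hc, h⟩
  obtain ⟨h1, h2, h3, -⟩ := pSq_of_mul_gaussian hE hc h
  exact ⟨h1, h2, h3⟩

lemma exists_unit_gaussian : ∃ γ : WaveSpace, (∀ᵐ l ∂nu, γ l = (gaussian E l : ℂ)) ∧
    ∃ c : ℂ, ‖c‖ = 1 ∧ ∀ᵐ l ∂nu, γ l = c * (gaussian E l : ℂ) := by
  obtain ⟨γ, hγ⟩ := exists_gaussian hE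
  exact ⟨γ, hγ, 1, norm_one, by simpa using hγ⟩

theorem isLeast_fourierError : IsLeast {d : ℝ≥0∞ | ∃ φ : WaveSpace, ‖φ‖ = 1 ∧
    qSq φ ≤ ENNReal.ofReal E ∧ d = fourierError φ} (ENNReal.ofReal (1 / (4 * E))) := by
  obtain ⟨γ, -, hγ⟩ := exists_unit_gaussian hE
  obtain ⟨h1, h2, h3⟩ := (fourierError_eq_iff hE γ).2 hγ
  refine ⟨⟨γ, h1, h2, h3.symm⟩, ?_⟩
  rintro d ⟨φ, hn, hq, rfl⟩
  exact le_fourierError hE hn hq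

theorem isLeast_pSq : IsLeast {d : ℝ≥0∞ | ∃ φ : WaveSpace, ‖φ‖ = 1 ∧
    qSq φ ≤ ENNReal.ofReal E ∧ d = pSq φ} (ENNReal.ofReal (1 / (4 * E))) := by
  obtain ⟨γ, -, hγ⟩ := exists_unit_gaussian hE
  obtain ⟨h1, h2, h3⟩ := (pSq_eq_iff hE γ).2 hγ
  refine ⟨⟨γ, h1, h2, h3.symm⟩, ?_⟩
  rintro d ⟨φ, hn, hq, rfl⟩
  exact (le_fourierError hE hn hq).trans (fourierError_le_pSq φ)

/-! #### Mixed states and covariant measurements -/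

lemma exists_phase_of_mixedCost_le {M : POVM WaveSpace} (hM : M.IsCovariant)
    {ρ : DensityOp WaveSpace} (h : mixedCost E M ρ ≤ 1) :
    ∃ φ : WaveSpace, (∀ᵐ l ∂nu, ‖φ l‖ = gaussian E l) ∧
      ρ.op = InnerProductSpace.rankOne ℂ φ φ := by
  obtain ⟨φ, hφ, hc, hρ⟩ := exists_pure_of_mixedCost_le hE hM h
  refine ⟨φ, ?_, hρ⟩
  filter_upwards [norm_sq_eq_of_cost_le hE hM hc] with l hl
  rw [hφ, one_pow, one_mul] at hl
  exact (pow_left_inj₀ (norm_nonneg _) (gaussian_pos hE l).le two_ne_zero).1 hl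

lemma exists_gaussian_of_mixedCost_le {ρ : DensityOp WaveSpace}
    (h : mixedCost E fourierPOVM ρ ≤ 1) :
    ∃ φ : WaveSpace, (∀ᵐ l ∂nu, φ l = (gaussian E l : ℂ)) ∧
      ρ.op = InnerProductSpace.rankOne ℂ φ φ := by
  obtain ⟨γ, hγ⟩ := exists_gaussian hE
  obtain ⟨φ, hφ, hc, hρ⟩ := exists_pure_of_mixedCost_le hE fourierPOVM_isCovariant h
  obtain ⟨c, hc1, rfl⟩ := eq_smul_gaussian hE hφ hc hγ
  refine ⟨γ, hγ, ?_⟩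
  rw [hρ]
  ext1 x
  rw [InnerProductSpace.rankOne_apply, InnerProductSpace.rankOne_apply, inner_smul_left, smul_smul,
    mul_right_comm, Complex.conj_mul', hc1]
  simp

lemma energy_of_phase {ρ : DensityOp WaveSpace} {φ : WaveSpace}
    (hφ : ∀ᵐ l ∂nu, ‖φ l‖ = gaussian E l) (hρ : ρ.op = InnerProductSpace.rankOne ℂ φ φ) :
    energy ρ = ENNReal.ofReal E := by
  rw [energy_of_op_eq (norm_of_norm_eq_gaussian hE hφ) hρ, qSq_of_norm_eq_gaussian hE hφ]

lemma worstError_of_gaussian {ρ : DensityOp WaveSpace} {φ : WaveSpace}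
    (hφ : ∀ᵐ l ∂nu, φ l = (gaussian E l : ℂ)) (hρ : ρ.op = InnerProductSpace.rankOne ℂ φ φ) :
    worstError ρ fourierPOVM = ENNReal.ofReal (1 / (4 * E)) := by
  rw [worstError_of_op_eq (norm_of_norm_eq_gaussian hE (norm_eq_gaussian hE hφ)) hρ
    fourierPOVM_isCovariant, fourierPOVM_secondMoment, fourierError_gaussian hE hφ]

lemma exists_worstError_of_phase {ρ : DensityOp WaveSpace} {φ : WaveSpace}
    (hφ : ∀ᵐ l ∂nu, ‖φ l‖ = gaussian E l) (hρ : ρ.op = InnerProductSpace.rankOne ℂ φ φ) :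
    ∃ M : POVM WaveSpace, M.IsCovariant ∧ worstError ρ M = ENNReal.ofReal (1 / (4 * E)) := by
  obtain ⟨M, hM, h⟩ := exists_povm_of_norm_eq_gaussian hE hφ
  exact ⟨M, hM, by rw [worstError_of_op_eq (norm_of_norm_eq_gaussian hE hφ) hρ hM, h]⟩

theorem worstError_fourierPOVM_eq_iff (ρ : DensityOp WaveSpace) :
    (energy ρ ≤ ENNReal.ofReal E ∧
        worstError ρ fourierPOVM = ENNReal.ofReal (1 / (4 * E))) ↔
      ∃ φ : WaveSpace, (∀ᵐ l ∂nu, φ l = (gaussian E l : ℂ)) ∧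
        ρ.op = InnerProductSpace.rankOne ℂ φ φ := by
  constructor
  · rintro ⟨h1, h2⟩
    exact exists_gaussian_of_mixedCost_le hE (cost_le_one hE h1 h2.le)
  · rintro ⟨φ, hφ, hρ⟩
    exact ⟨(energy_of_phase hE (norm_eq_gaussian hE hφ) hρ).le, worstError_of_gaussian hE hφ hρ⟩

theorem exists_worstError_eq_iff (ρ : DensityOp WaveSpace) :
    (energy ρ ≤ ENNReal.ofReal E ∧ ∃ M : POVM WaveSpace, M.IsCovariant ∧
        worstError ρ M = ENNReal.ofReal (1 / (4 * E))) ↔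
      ∃ φ : WaveSpace, (∀ᵐ l ∂nu, ‖φ l‖ = gaussian E l) ∧
        ρ.op = InnerProductSpace.rankOne ℂ φ φ := by
  constructor
  · rintro ⟨h1, M, hM, h2⟩
    exact exists_phase_of_mixedCost_le hE hM (cost_le_one hE h1 h2.le)
  · rintro ⟨φ, hφ, hρ⟩
    exact ⟨(energy_of_phase hE hφ hρ).le, exists_worstError_of_phase hE hφ hρ⟩

/-! #### Randomised schemes -/

omit hE in
-- Linearity of the cost in the averaged energy and error is what makes randomisation useless.
lemma tsum_mul_mixedCost (p : PMF ℕ) (ρ : ℕ → DensityOp WaveSpace) (M : ℕ → POVM WaveSpace) :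
    ∑' i, p i * mixedCost E (M i) (ρ i) =
      ENNReal.ofReal (1 / (2 * E)) * ∑' i, p i * energy (ρ i) +
        ENNReal.ofReal (2 * E) * ∑' i, p i * worstError (ρ i) (M i) := by
  rw [← ENNReal.tsum_mul_left, ← ENNReal.tsum_mul_left, ← ENNReal.tsum_add]
  refine tsum_congr fun i => ?_
  rw [mixedCost]
  ring

lemma one_le_tsum_mul_mixedCost (p : PMF ℕ) (ρ : ℕ → DensityOp WaveSpace)
    {M : ℕ → POVM WaveSpace} (hM : ∀ i, (M i).IsCovariant) :
    1 ≤ ∑' i, p i * mixedCost E (M i) (ρ i) := by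
  rw [← p.tsum_coe]
  exact ENNReal.tsum_le_tsum fun i => le_mul_of_one_le_right' (one_le_mixedCost hE (hM i) (ρ i))

/-- The energy is constrained only on average, but every cost is at least 1 and their average at
most 1, so no index of positive weight can exceed 1. -/
lemma mixedCost_le_one_of_tsum {p : PMF ℕ} {ρ : ℕ → DensityOp WaveSpace}
    {M : ℕ → POVM WaveSpace} (hM : ∀ i, (M i).IsCovariant)
    (he : ∑' i, p i * energy (ρ i) ≤ ENNReal.ofReal E)
    (hd : ∑' i, p i * worstError (ρ i) (M i) = ENNReal.ofReal (1 / (4 * E))) {i : ℕ}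
    (hi : p i ≠ 0) : mixedCost E (M i) (ρ i) ≤ 1 := by
  have h := cost_le_one hE he hd.le
  rw [← tsum_mul_mixedCost] at h
  by_contra! hlt
  have h1 : p i < p i * mixedCost E (M i) (ρ i) := by
    conv_lhs => rw [← mul_one (p i)]
    exact ENNReal.mul_lt_mul_right hi (p.apply_ne_top i) hlt
  have h2 := ENNReal.tsum_lt_tsum (f := p) (by rw [p.tsum_coe]; simp)
    (fun j => le_mul_of_one_le_right' (one_le_mixedCost hE (hM j) (ρ j))) h1
  rw [p.tsum_coe] at h2
  exact absurd h (not_le.2 h2)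

omit hE in
lemma tsum_mul_eq (p : PMF ℕ) {f : ℕ → ℝ≥0∞} {a : ℝ≥0∞} (h : ∀ i, p i ≠ 0 → f i = a) :
    ∑' i, p i * f i = a := by
  have e : ∀ i, p i * f i = p i * a := fun i => by
    by_cases hi : p i = 0
    · rw [hi, zero_mul, zero_mul]
    · rw [h i hi]
  simp only [e]
  rw [ENNReal.tsum_mul_right, p.tsum_coe, one_mul]

theorem tsum_worstError_fourierPOVM_eq_iff (p : PMF ℕ) (ρ : ℕ → DensityOp WaveSpace) :
    (∑' i, p i * energy (ρ i) ≤ ENNReal.ofReal E ∧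
        ∑' i, p i * worstError (ρ i) fourierPOVM = ENNReal.ofReal (1 / (4 * E))) ↔
      ∀ i, p i ≠ 0 → ∃ φ : WaveSpace, (∀ᵐ l ∂nu, φ l = (gaussian E l : ℂ)) ∧
        (ρ i).op = InnerProductSpace.rankOne ℂ φ φ := by
  constructor
  · rintro ⟨h1, h2⟩ i hi
    exact exists_gaussian_of_mixedCost_le hE (mixedCost_le_one_of_tsum (M := fun _ => fourierPOVM)
      hE (fun _ => fourierPOVM_isCovariant) h1 h2 hi)
  · intro h
    refine ⟨(tsum_mul_eq p fun i hi => ?_).le, tsum_mul_eq p fun i hi => ?_⟩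
    · obtain ⟨φ, hφ, hρ⟩ := h i hi
      exact energy_of_phase hE (norm_eq_gaussian hE hφ) hρ
    · obtain ⟨φ, hφ, hρ⟩ := h i hi
      exact worstError_of_gaussian hE hφ hρ

theorem exists_tsum_worstError_eq_iff (p : PMF ℕ) (ρ : ℕ → DensityOp WaveSpace) :
    (∑' i, p i * energy (ρ i) ≤ ENNReal.ofReal E ∧
        ∃ M : ℕ → POVM WaveSpace, (∀ i, (M i).IsCovariant) ∧
          ∑' i, p i * worstError (ρ i) (M i) = ENNReal.ofReal (1 / (4 * E))) ↔
      ∀ i, p i ≠ 0 → ∃ φ : WaveSpace, (∀ᵐ l ∂nu, ‖φ l‖ = gaussian E l) ∧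
        (ρ i).op = InnerProductSpace.rankOne ℂ φ φ := by
  constructor
  · rintro ⟨h1, M, hM, h2⟩ i hi
    exact exists_phase_of_mixedCost_le hE (hM i) (mixedCost_le_one_of_tsum hE hM h1 h2 hi)
  · intro h
    refine ⟨(tsum_mul_eq p fun i hi => ?_).le, ?_⟩
    · obtain ⟨φ, hφ, hρ⟩ := h i hi
      exact energy_of_phase hE hφ hρ
    -- At indices of weight zero any covariant measurement will do, since its error does not enter
    -- the sum.
    · have hM : ∀ i, ∃ M : POVM WaveSpace, M.IsCovariant ∧
          (p i ≠ 0 → worstError (ρ i) M = ENNReal.ofReal (1 / (4 * E))) := by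
        intro i
        by_cases hi : p i = 0
        · exact ⟨fourierPOVM, fourierPOVM_isCovariant, fun h0 => absurd hi h0⟩
        · obtain ⟨φ, hφ, hρ⟩ := h i hi
          obtain ⟨M, hM, hd⟩ := exists_worstError_of_phase hE hφ hρ
          exact ⟨M, hM, fun _ => hd⟩
      choose M hM hd using hM
      exact ⟨M, hM, tsum_mul_eq p hd⟩

/-! #### The minima of the two schemes -/

theorem isLeast_worstError : IsLeast {d : ℝ≥0∞ | ∃ (ρ : DensityOp WaveSpace)
    (M : POVM WaveSpace), M.IsCovariant ∧ energy ρ ≤ ENNReal.ofReal E ∧ d = worstError ρ M}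
    (ENNReal.ofReal (1 / (4 * E))) := by
  obtain ⟨γ, hγ, -⟩ := exists_unit_gaussian hE
  have hγ1 := norm_of_norm_eq_gaussian hE (norm_eq_gaussian hE hγ)
  obtain ⟨h1, h2⟩ := (worstError_fourierPOVM_eq_iff hE (pureState γ hγ1)).2 ⟨γ, hγ, rfl⟩
  refine ⟨⟨pureState γ hγ1, fourierPOVM, fourierPOVM_isCovariant, h1, h2.symm⟩, ?_⟩
  rintro d ⟨ρ, M, hM, he, rfl⟩
  exact le_of_one_le_cost hE he (one_le_mixedCost hE hM ρ)

theorem isLeast_tsum_worstError : IsLeast {d : ℝ≥0∞ | ∃ (p : PMF ℕ)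
    (ρ : ℕ → DensityOp WaveSpace) (M : ℕ → POVM WaveSpace), (∀ i, (M i).IsCovariant) ∧
      ∑' i, p i * energy (ρ i) ≤ ENNReal.ofReal E ∧ d = ∑' i, p i * worstError (ρ i) (M i)}
    (ENNReal.ofReal (1 / (4 * E))) := by
  obtain ⟨γ, hγ, -⟩ := exists_unit_gaussian hE
  have hγ1 := norm_of_norm_eq_gaussian hE (norm_eq_gaussian hE hγ)
  -- A scheme without randomness already attains the minimum.
  obtain ⟨h1, h2⟩ := (tsum_worstError_fourierPOVM_eq_iff hE (PMF.pure 0)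
    fun _ => pureState γ hγ1).2 fun _ _ => ⟨γ, hγ, rfl⟩
  refine ⟨⟨PMF.pure 0, fun _ => pureState γ hγ1, fun _ => fourierPOVM,
    fun _ => fourierPOVM_isCovariant, h1, h2.symm⟩, ?_⟩
  rintro d ⟨p, ρ, M, hM, he, rfl⟩
  refine le_of_one_le_cost hE he ?_
  rw [← tsum_mul_mixedCost]
  exact one_le_tsum_mul_mixedCost hE p ρ hM

end Minimum

/-! ### The outcome density of the Fourier measurement and the final theorem. -/

lemma inner_fourierPOVM {B : Set ℝ} (hB : MeasurableSet B) (φ : WaveSpace) :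
    ⟪φ, fourierPOVM.eff B φ⟫_ℂ = ((∫ g in B, ‖invFourier φ g‖ ^ 2 ∂nu : ℝ) : ℂ) := by
  rw [fourierPOVM, isoPOVM_inner _ hB]
  congr 1
  refine integral_congr_ae (ae_restrict_of_ae ?_)
  filter_upwards [fourierIso_coeFn φ] with g hg
  rw [hg]

end RealShift

theorem mainTheorem3 (E : ℝ) (hE : 0 < E) :
    -- the four minima
    IsLeast {d : ℝ≥0∞ | ∃ (ρ : DensityOp WaveSpace)
        (M : POVM WaveSpace), M.IsCovariant ∧
        energy ρ ≤ ENNReal.ofReal E ∧ d = worstError ρ M}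
      (ENNReal.ofReal (1 / (4 * E))) ∧
    IsLeast {d : ℝ≥0∞ | ∃ (p : PMF ℕ) (ρ : ℕ → DensityOp WaveSpace)
        (M : ℕ → POVM WaveSpace), (∀ i, (M i).IsCovariant) ∧
        ∑' i, p i * energy (ρ i) ≤ ENNReal.ofReal E ∧
        d = ∑' i, p i * worstError (ρ i) (M i)}
      (ENNReal.ofReal (1 / (4 * E))) ∧
    IsLeast {d : ℝ≥0∞ | ∃ φ : WaveSpace, ‖φ‖ = 1 ∧
        qSq φ ≤ ENNReal.ofReal E ∧ d = fourierError φ}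
      (ENNReal.ofReal (1 / (4 * E))) ∧
    IsLeast {d : ℝ≥0∞ | ∃ φ : WaveSpace, ‖φ‖ = 1 ∧
        qSq φ ≤ ENNReal.ofReal E ∧ d = pSq φ}
      (ENNReal.ofReal (1 / (4 * E))) ∧
    -- attainment in the two pure-state problems
    (∀ φ : WaveSpace,
      (‖φ‖ = 1 ∧ qSq φ ≤ ENNReal.ofReal E ∧
          fourierError φ = ENNReal.ofReal (1 / (4 * E))) ↔
        ∃ c : ℂ, ‖c‖ = 1 ∧ ∀ᵐ l ∂nu, φ l = c * (gaussian E l : ℂ)) ∧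
    (∀ φ : WaveSpace,
      (‖φ‖ = 1 ∧ qSq φ ≤ ENNReal.ofReal E ∧
          pSq φ = ENNReal.ofReal (1 / (4 * E))) ↔
        ∃ c : ℂ, ‖c‖ = 1 ∧ ∀ᵐ l ∂nu, φ l = c * (gaussian E l : ℂ)) ∧
    -- inverse Fourier transform of the Gaussian
    (∀ φ : WaveSpace, (∀ᵐ l ∂nu, φ l = (gaussian E l : ℂ)) →
      ∀ᵐ g ∂nu, invFourier φ g =
        (((4 * E) ^ (1 / 4 : ℝ) * Real.exp (-E * g ^ 2) : ℝ) : ℂ)) ∧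
    -- attainment in Schemes 1 and 2 with the covariant measurement |I⟩⟨I|
    (∃ M₀ : POVM WaveSpace, M₀.IsCovariant ∧
      (∀ B : Set ℝ, MeasurableSet B → ∀ φ : WaveSpace,
        inner ℂ φ (M₀.eff B φ) =
          ((∫ g in B, ‖invFourier φ g‖ ^ 2 ∂nu : ℝ) : ℂ)) ∧
      (∀ ρ : DensityOp WaveSpace,
        (energy ρ ≤ ENNReal.ofReal E ∧
            worstError ρ M₀ = ENNReal.ofReal (1 / (4 * E))) ↔
          ∃ φ : WaveSpace,
            (∀ᵐ l ∂nu, φ l = (gaussian E l : ℂ)) ∧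
            ρ.op = InnerProductSpace.rankOne ℂ φ φ) ∧
      (∀ (p : PMF ℕ) (ρ : ℕ → DensityOp WaveSpace),
        (∑' i, p i * energy (ρ i) ≤ ENNReal.ofReal E ∧
            ∑' i, p i * worstError (ρ i) M₀ = ENNReal.ofReal (1 / (4 * E))) ↔
          ∀ i, p i ≠ 0 → ∃ φ : WaveSpace,
            (∀ᵐ l ∂nu, φ l = (gaussian E l : ℂ)) ∧
            (ρ i).op = InnerProductSpace.rankOne ℂ φ φ)) ∧
    -- attainment in Schemes 1 and 2 with free choice of the covariant measurement
    (∀ ρ : DensityOp WaveSpace,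
      (energy ρ ≤ ENNReal.ofReal E ∧
          ∃ M : POVM WaveSpace, M.IsCovariant ∧
            worstError ρ M = ENNReal.ofReal (1 / (4 * E))) ↔
        ∃ φ : WaveSpace,
          (∀ᵐ l ∂nu, ‖φ l‖ = gaussian E l) ∧
          ρ.op = InnerProductSpace.rankOne ℂ φ φ) ∧
    (∀ (p : PMF ℕ) (ρ : ℕ → DensityOp WaveSpace),
      (∑' i, p i * energy (ρ i) ≤ ENNReal.ofReal E ∧
          ∃ M : ℕ → POVM WaveSpace, (∀ i, (M i).IsCovariant) ∧
            ∑' i, p i * worstError (ρ i) (M i) = ENNReal.ofReal (1 / (4 * E))) ↔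
        ∀ i, p i ≠ 0 → ∃ φ : WaveSpace,
          (∀ᵐ l ∂nu, ‖φ l‖ = gaussian E l) ∧
          (ρ i).op = InnerProductSpace.rankOne ℂ φ φ) :=
  ⟨isLeast_worstError hE, isLeast_tsum_worstError hE, isLeast_fourierError hE, isLeast_pSq hE,
    fourierError_eq_iff hE, pSq_eq_iff hE, fun _ h => invFourier_gaussian hE h,
    ⟨fourierPOVM, fourierPOVM_isCovariant, fun _ hB φ => inner_fourierPOVM hB φ,
      worstError_fourierPOVM_eq_iff hE, tsum_worstError_fourierPOVM_eq_iff hE⟩,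
    exists_worstError_eq_iff hE, exists_tsum_worstError_eq_iff hE⟩
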